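/- Let $\mathbb K$ be an algebraically closed field of characteristic $0$, let $d\ge 0$ and $N\ge 1$, and let $A=\{\chi_1,\dots,\chi_r\}\subset\mathbb Z^{d}$ be a set of $r$ distinct points whose affine span is $\mathbb R^{d}$; put $P=\mathrm{conv}(A)$. Order $\mathbb Q^N$ and $\mathbb R^N$ lexicographically, the first (top) coordinate being the most significant. **Coordinate ring.** Let $\hat X_A\subseteq\mathbb K^r$ be the Zariski closure of the image of $\mathbb K^*\times(\mathbb K^*)^{d}\to\mathbb K^r$, $(c,t)\mapsto(c\,t^{\chi_1},\dots,c\,t^{\chi_r})$ (the affine cone over the embedded projective toric variety $X_A$), let $\mathbb K[\hat X_A]$ be its coordinate ring, and let $\rho:\mathbb K[x_1,\dots,x_r]\to\mathbb K[\hat X_A]$ be the restriction map. **Quasi-valuation.** For $\Psi\in M_{N,r}(\mathbb Q)$ and a nonzero polynomial $p=\sum_\alpha a_\alpha x^\alpha$ put $\mathfrak v_\Psi(p)=\min\{\Psi\cdot\alpha\mid a_\alpha\neq0\}$, and $\mathfrak v_\Psi(0)=\infty$. For $f\in\mathbb K[\hat X_A]$ put $\nu_\Psi(f)=\max\{\mathfrak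 v_\Psi(p)\mid\rho(p)=f\}$ (the maximum exists, and $\nu_\Psi$ is a quasi-valuation with values in $\mathbb Q^N\cup\{\infty\}$). Let $$\mathrm{gr}_{\nu_\Psi}\mathbb K[\hat X_A]=\bigoplus_{\mathbf a\in\mathbb Q^N}\{f\mid\nu_\Psi(f)\ge\mathbf a\}/\{f\mid\nu_\Psi(f)>\mathbf a\}$$ be the associated graded algebra; for $f\ne0$ let $\bar f$ be the class of $f$ in degree $\nu_\Psi(f)$. For a commutative ring $B$ let $\mathrm{Red}(B)$ be the quotient of $B$ by its nilradical. **Subdivisions.** A polytopal subdivision of $(P,A)$ is a finite set $\mathcal Q$ of pairs $(Q,A_Q)$ with $A_Q\subseteq A$ and $Q=\mathrm{conv}(A_Q)$ of dimension $d$, such that the polytopes $Q$ cover $P$ and, for two different pairs $(Q,A_Q),(Q',A_{Q'})$, the intersection $Q\cap Q'$ is empty or a face of both, and $A_Q\cap Q\cap Q'=A_{Q'}\cap Q\cap Q'$. Put $A_{\mathcal Q}=\bigcup_Q A_Q$. A triangulation is a polytopal subdivision in which every $Q$ is a simplex with vertex set $A_Q$. **GKZ-cone.** Identify $\mathbb R^{d}$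 with $\{1\}\times\mathbb R^{d}\subset\mathbb R\times\mathbb R^{d}$, write $K(D)$ for the cone over $D\subseteq\mathbb R^d$, and $\Psi(\chi)$ for the column of $\Psi$ belonging to $\chi\in A$. The (open) GKZ-cone $C(\mathcal Q,N)\subseteq M_{N,r}(\mathbb R)$ is the set of those $\Psi$ for which there is a continuous map $g:K(P)\to\mathbb R^N$ that is linear on $K(Q)$ for all $Q\in\mathcal Q$, is convex upward, i.e. $g(tu+(1-t)v)\ge tg(u)+(1-t)g(v)$ for $u,v\in K(P)$, $t\in[0,1]$, and satisfies $g(\chi)=\Psi(\chi)$ for $\chi\in A_{\mathcal Q}$ and $g(\chi)\ge\Psi(\chi)$ for $\chi\in A\setminus A_{\mathcal Q}$; and such that moreover the domains of linearity of $g$ are exactly the polytopes $Q$ of $\mathcal Q$, with $A_Q=\{\chi\in A\cap Q\mid g(\chi)=\Psi(\chi)\}$ for each of them. Here a domain of linearity is a maximal set $D$ among the closures of nonempty connected relatively open subsets of $P$ such that $g|_{K(D)}$ is the restriction of a linear map. (The subdivision $\mathcal Q$ is regular if and only if $C(\mathcal Q,N)\neq\varnothing$.) **Statement.** Let $\mathcal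 T$ be a (regular) triangulation of $(P,A)$ and let $\Psi\in M_{N,r}(\mathbb Q)$ be a matrix in $C(\mathcal T,N)$. Then $\mathrm{Red}(\mathrm{gr}_{\nu_\Psi}\mathbb K[\hat X_A])$ is the Stanley–Reisner algebra of $\mathcal T$ over $\mathbb K$: there is an isomorphism of $\mathbb K$-algebras $$\mathbb K[x_\chi\mid\chi\in A_{\mathcal T}]\,\Big/\,\Big(\prod_{\chi\in F}x_\chi\ \Big|\ \varnothing\ne F\subseteq A_{\mathcal T},\ F\not\subseteq A_Q\text{ for all }Q\in\mathcal T\Big)\;\longrightarrow\;\mathrm{Red}(\mathrm{gr}_{\nu_\Psi}\mathbb K[\hat X_A])$$ that maps the class of $x_{\chi_i}$ to the class of $\overline{\rho(x_i)}$ for every $\chi_i\in A_{\mathcal T}$. -/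

import Mathlib

open scoped DirectSum

noncomputable section

namespace GKZ

/-! ### Quasi-valuations and associated graded algebras -/

/-- A quasi-valuation on a `K`-algebra `R` with values in a totally ordered abelian group `Γ`.
The normalisation `map_one` makes the associated graded algebra unital. -/
structure QuasiValuation (K R Γ : Type*) [Field K] [CommRing R] [Algebra K R]
    [AddCommGroup Γ] [LinearOrder Γ] [IsOrderedAddMonoid Γ] where
  toFun : R → WithTop Γ
  map_eq_top_iff : ∀ x, toFun x = ⊤ ↔ x = 0
  map_one : toFun 1 = 0
  min_le_map_add : ∀ x y, min (toFun x) (toFun y) ≤ toFun (x + y)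
  map_smul : ∀ (c : K) (x : R), c ≠ 0 → toFun (c • x) = toFun x
  add_le_map_mul : ∀ x y, toFun x + toFun y ≤ toFun (x * y)

namespace QuasiValuation

variable {K R Γ : Type*} [Field K] [CommRing R] [Algebra K R]
  [AddCommGroup Γ] [LinearOrder Γ] [IsOrderedAddMonoid Γ] (ν : QuasiValuation K R Γ)

theorem map_zero : ν.toFun 0 = ⊤ := (ν.map_eq_top_iff 0).2 rfl

/-- The subspace `{f | ν f ≥ a}`. -/
def geSub (a : Γ) : Submodule K R where
  carrier := {f | (a : WithTop Γ) ≤ ν.toFun f}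
  zero_mem' := by simp [ν.map_zero]
  add_mem' {x y} hx hy := le_trans (le_min hx hy) (ν.min_le_map_add x y)
  smul_mem' c x hx := by
    rcases eq_or_ne c 0 with rfl | hc
    · simp [ν.map_zero]
    · simpa [ν.map_smul c x hc] using hx

/-- The subspace `{f | ν f > a}`. -/
def gtSub (a : Γ) : Submodule K R where
  carrier := {f | (a : WithTop Γ) < ν.toFun f}
  zero_mem' := by simp [ν.map_zero]
  add_mem' {x y} hx hy := lt_of_lt_of_le (lt_min hx hy) (ν.min_le_map_add x y)
  smul_mem' c x hx := by
    rcases eq_or_ne c 0 with rfl | hc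
    · simp [ν.map_zero]
    · simpa [ν.map_smul c x hc] using hx

theorem mem_geSub {a : Γ} {f : R} : f ∈ ν.geSub a ↔ (a : WithTop Γ) ≤ ν.toFun f := Iff.rfl

theorem mem_gtSub {a : Γ} {f : R} : f ∈ ν.gtSub a ↔ (a : WithTop Γ) < ν.toFun f := Iff.rfl

theorem mul_mem_geSub {a b : Γ} {x y : R} (hx : x ∈ ν.geSub a) (hy : y ∈ ν.geSub b) :
    x * y ∈ ν.geSub (a + b) := by
  rw [mem_geSub] at *
  rw [WithTop.coe_add]
  exact (add_le_add hx hy).trans (ν.add_le_map_mul x y)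

theorem mul_mem_gtSub_right {a b : Γ} {x y : R} (hx : x ∈ ν.geSub a) (hy : y ∈ ν.gtSub b) :
    x * y ∈ ν.gtSub (a + b) := by
  rw [mem_geSub] at hx
  rw [mem_gtSub] at *
  rw [WithTop.coe_add]
  refine lt_of_lt_of_le ?_ (ν.add_le_map_mul x y)
  exact lt_of_lt_of_le (WithTop.add_lt_add_left WithTop.coe_ne_top hy) (by gcongr)

theorem mul_mem_gtSub_left {a b : Γ} {x y : R} (hx : x ∈ ν.gtSub a) (hy : y ∈ ν.geSub b) :
    x * y ∈ ν.gtSub (a + b) := by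
  rw [mul_comm, add_comm]
  exact ν.mul_mem_gtSub_right hy hx

theorem one_mem_geSub : (1 : R) ∈ ν.geSub 0 := by
  rw [mem_geSub, ν.map_one]; rfl

/-- The leaf `{f | ν f ≥ a} / {f | ν f > a}` of the filtration of `ν`. -/
def leaf (a : Γ) : Type _ := ν.geSub a ⧸ (ν.gtSub a).submoduleOf (ν.geSub a)

instance (a : Γ) : AddCommGroup (ν.leaf a) :=
  inferInstanceAs (AddCommGroup (ν.geSub a ⧸ (ν.gtSub a).submoduleOf (ν.geSub a)))

instance (a : Γ) : Module K (ν.leaf a) :=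
  inferInstanceAs (Module K (ν.geSub a ⧸ (ν.gtSub a).submoduleOf (ν.geSub a)))

/-- The quotient map onto a leaf. -/
def toLeaf (a : Γ) : ν.geSub a →ₗ[K] ν.leaf a := ((ν.gtSub a).submoduleOf (ν.geSub a)).mkQ

/-- The class in the leaf of degree `a` of an element `f` with `ν f ≥ a`. -/
abbrev leafMk (a : Γ) (f : R) (hf : f ∈ ν.geSub a) : ν.leaf a := ν.toLeaf a ⟨f, hf⟩

theorem leafMk_eq_zero {a : Γ} {f : R} (hf : f ∈ ν.geSub a) (h : f ∈ ν.gtSub a) :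
    ν.leafMk a f hf = 0 :=
  (Submodule.Quotient.mk_eq_zero _).2 h

/-- The product of two elements, as an element of a leaf. -/
def leafPreMul (a b : Γ) : ν.geSub a →ₗ[K] ν.geSub b →ₗ[K] ν.leaf (a + b) :=
  LinearMap.mk₂ K (fun x y => ν.leafMk (a + b) (x.1 * y.1) (ν.mul_mem_geSub x.2 y.2))
    (fun x x' y => by
      rw [← _root_.map_add]; exact congrArg _ (Subtype.ext (add_mul x.1 x'.1 y.1)))
    (fun c x y => by
      rw [← _root_.map_smul]; exact congrArg _ (Subtype.ext (smul_mul_assoc c x.1 y.1)))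
    (fun x y y' => by
      rw [← _root_.map_add]; exact congrArg _ (Subtype.ext (mul_add x.1 y.1 y'.1)))
    (fun c x y => by
      rw [← _root_.map_smul]; exact congrArg _ (Subtype.ext (mul_smul_comm c x.1 y.1)))

theorem leafPreMul_right (a b : Γ) :
    (ν.gtSub b).submoduleOf (ν.geSub b) ≤ LinearMap.ker (ν.leafPreMul a b).flip := fun _ hy =>
  LinearMap.mem_ker.2 (LinearMap.ext fun x =>
    ν.leafMk_eq_zero _ (ν.mul_mem_gtSub_right x.2 hy))

/-- The product of an element with an element of a leaf. -/
def leafHalfMul (a b : Γ) : ν.leaf b →ₗ[K] ν.geSub a →ₗ[K] ν.leaf (a + b) :=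
  Submodule.liftQ _ (ν.leafPreMul a b).flip (ν.leafPreMul_right a b)

theorem leafHalfMul_left (a b : Γ) :
    (ν.gtSub a).submoduleOf (ν.geSub a) ≤ LinearMap.ker (ν.leafHalfMul a b).flip := fun x hx =>
  LinearMap.mem_ker.2 (LinearMap.ext fun y => by
    obtain ⟨y, rfl⟩ := Submodule.Quotient.mk_surjective _ y
    exact ν.leafMk_eq_zero _ (ν.mul_mem_gtSub_left hx y.2))

/-- Multiplication on leaves, induced by multiplication of representatives. -/
def leafMul (a b : Γ) : ν.leaf a →ₗ[K] ν.leaf b →ₗ[K] ν.leaf (a + b) :=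
  Submodule.liftQ _ (ν.leafHalfMul a b).flip (ν.leafHalfMul_left a b)

theorem leafMul_mk {a b : Γ} {x y : R} (hx : x ∈ ν.geSub a) (hy : y ∈ ν.geSub b) :
    ν.leafMul a b (ν.leafMk a x hx) (ν.leafMk b y hy) =
      ν.leafMk (a + b) (x * y) (ν.mul_mem_geSub hx hy) := rfl

theorem gradedMonoid_mk_eq {a b : Γ} {x y : R} (hx : x ∈ ν.geSub a) (hy : y ∈ ν.geSub b)
    (hab : a = b) (hxy : x = y) :
    GradedMonoid.mk (A := ν.leaf) a (ν.leafMk a x hx) =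
      GradedMonoid.mk (A := ν.leaf) b (ν.leafMk b y hy) := by
  subst hab; subst hxy; rfl

theorem exists_leafMk {a : Γ} (z : ν.leaf a) : ∃ x hx, z = ν.leafMk a x hx := by
  obtain ⟨⟨x, hx⟩, rfl⟩ := Submodule.Quotient.mk_surjective _ z
  exact ⟨x, hx, rfl⟩

instance : GradedMonoid.GMul ν.leaf where
  mul {a b} x y := ν.leafMul a b x y

instance : GradedMonoid.GOne ν.leaf where
  one := ν.leafMk 0 1 ν.one_mem_geSub

instance : GradedMonoid.GMonoid ν.leaf where
  one_mul := by
    rintro ⟨a, x⟩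
    obtain ⟨x, hx, rfl⟩ := ν.exists_leafMk x
    exact ν.gradedMonoid_mk_eq _ _ (zero_add a) (one_mul x)
  mul_one := by
    rintro ⟨a, x⟩
    obtain ⟨x, hx, rfl⟩ := ν.exists_leafMk x
    exact ν.gradedMonoid_mk_eq _ _ (add_zero a) (mul_one x)
  mul_assoc := by
    rintro ⟨a, x⟩ ⟨b, y⟩ ⟨c, z⟩
    obtain ⟨x, hx, rfl⟩ := ν.exists_leafMk x
    obtain ⟨y, hy, rfl⟩ := ν.exists_leafMk y
    obtain ⟨z, hz, rfl⟩ := ν.exists_leafMk z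
    exact ν.gradedMonoid_mk_eq _ _ (add_assoc a b c) (mul_assoc x y z)

/-- The scalars, as elements of degree zero. -/
def leafScalar : K →ₗ[K] ν.leaf 0 :=
  LinearMap.toSpanSingleton K (ν.leaf 0) (ν.leafMk 0 1 ν.one_mem_geSub)

theorem leafScalar_apply (c : K) :
    ν.leafScalar c = ν.leafMk 0 (c • 1) ((ν.geSub 0).smul_mem c ν.one_mem_geSub) := rfl

instance : DirectSum.GCommRing ν.leaf where
  mul_zero {a b} x := (ν.leafMul a b x).map_zero
  zero_mul {a b} y := by
    change ν.leafMul a b 0 y = 0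
    rw [_root_.map_zero]; rfl
  mul_add {a b} x y z := (ν.leafMul a b x).map_add y z
  add_mul {a b} x y z := by
    change ν.leafMul a b (x + y) z = ν.leafMul a b x z + ν.leafMul a b y z
    rw [_root_.map_add]; rfl
  mul_comm := by
    rintro ⟨a, x⟩ ⟨b, y⟩
    obtain ⟨x, hx, rfl⟩ := ν.exists_leafMk x
    obtain ⟨y, hy, rfl⟩ := ν.exists_leafMk y
    exact ν.gradedMonoid_mk_eq _ _ (add_comm a b) (mul_comm x y)
  natCast n := n • ν.leafMk 0 1 ν.one_mem_geSub
  natCast_zero := zero_smul _ _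
  natCast_succ n := succ_nsmul _ n
  intCast n := n • ν.leafMk 0 1 ν.one_mem_geSub
  intCast_ofNat n := natCast_zsmul _ n
  intCast_negSucc_ofNat n := negSucc_zsmul _ n

instance : DirectSum.GAlgebra K ν.leaf where
  toFun := ν.leafScalar.toAddMonoidHom
  map_one := one_smul K (ν.leafMk 0 1 ν.one_mem_geSub)
  map_mul c d := by
    exact ν.gradedMonoid_mk_eq _ _ (zero_add (0 : Γ)).symm (by simp [smul_smul, mul_comm])
  commutes := by
    rintro c ⟨a, x⟩
    obtain ⟨x, hx, rfl⟩ := ν.exists_leafMk x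
    exact ν.gradedMonoid_mk_eq _ _ (add_comm _ _) (mul_comm _ _)
  smul_def := by
    rintro c ⟨a, x⟩
    obtain ⟨x, hx, rfl⟩ := ν.exists_leafMk x
    exact ν.gradedMonoid_mk_eq _ _ (zero_add a).symm (by simp)

/-- The associated graded algebra `⨁ₐ {f | ν f ≥ a} / {f | ν f > a}`. -/
abbrev gr : Type _ := ⨁ a : Γ, ν.leaf a

/-- The class of `f` in the leaf of degree `ν f` (and `0` for `f = 0`). -/
def initialForm (f : R) : ν.gr :=
  if h : ν.toFun f = ⊤ then 0
  else DirectSum.of ν.leaf ((ν.toFun f).untop h)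
    (ν.leafMk _ f (by rw [mem_geSub, WithTop.coe_untop]))

end QuasiValuation

/-- The reduced algebra `Red(B) = B / nilradical(B)`. -/
abbrev Red (B : Type*) [CommRing B] : Type _ := B ⧸ nilradical B

/-! ### The toric variety of a point configuration -/

section Toric

variable (K : Type*) [Field K] {d r : ℕ} (χ : Fin r → Fin d → ℤ)

/-- The map `K* × (K*)^d → K^r`, `(c, t) ↦ (c t^{χ₁}, …, c t^{χᵣ})`. -/
def torusMap (p : Kˣ × (Fin d → Kˣ)) : Fin r → K :=
  fun i => ((p.1 * ∏ j, p.2 j ^ χ i j : Kˣ) : K)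

/-- The affine cone over the embedded projective toric variety: the Zariski closure of the image
of the torus. -/
def affineCone : Set (Fin r → K) :=
  MvPolynomial.zeroLocus K (MvPolynomial.vanishingIdeal K (Set.range (torusMap K χ)))

/-- The coordinate ring of the affine cone. -/
abbrev CoordRing : Type _ :=
  MvPolynomial (Fin r) K ⧸ MvPolynomial.vanishingIdeal K (affineCone K χ)

/-- The restriction of polynomial functions to the affine cone. -/
abbrev restr : MvPolynomial (Fin r) K →ₐ[K] CoordRing K χ := Ideal.Quotient.mkₐ K _

variable {K χ}

theorem mem_vanishingIdeal_affineCone {p : MvPolynomial (Fin r) K} :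
    p ∈ MvPolynomial.vanishingIdeal K (affineCone K χ) ↔
      ∀ t, MvPolynomial.eval (torusMap K χ t) p = 0 := by
  constructor
  · intro h t
    have := h (torusMap K χ t) (fun q hq => hq _ ⟨t, rfl⟩)
    simpa [MvPolynomial.aeval_eq_eval] using this
  · intro h x hx
    refine hx p ?_
    rintro _ ⟨t, rfl⟩
    simpa [MvPolynomial.aeval_eq_eval] using h t

theorem eval_torusMap_mul (p : MvPolynomial (Fin r) K) (b c : Kˣ) (t : Fin d → Kˣ) :
    MvPolynomial.eval (torusMap K χ (b * c, t)) p =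
      ∑ m ∈ Finset.range (p.totalDegree + 1),
        (b : K) ^ m * MvPolynomial.eval (torusMap K χ (c, t))
          (MvPolynomial.homogeneousComponent m p) := by
  conv_lhs => rw [← MvPolynomial.sum_homogeneousComponent p, map_sum]
  refine Finset.sum_congr rfl fun m _ => ?_
  have h := MvPolynomial.homogeneousComponent_isHomogeneous m p
  rw [MvPolynomial.eval_eq, MvPolynomial.eval_eq, Finset.mul_sum]
  refine Finset.sum_congr rfl fun α hα => ?_
  have hdeg : ∑ i ∈ α.support, α i = m := by
    have := h (MvPolynomial.mem_support_iff.1 hα)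
    simpa [Finsupp.weight_apply, Finsupp.sum] using this
  have : ∀ i, torusMap K χ (b * c, t) i = b * torusMap K χ (c, t) i := by
    intro i; simp [torusMap, mul_assoc]
  simp only [this, mul_pow, Finset.prod_mul_distrib, Finset.prod_pow_eq_pow_sum, hdeg]
  ring

theorem homogeneousComponent_mem [Infinite K] {p : MvPolynomial (Fin r) K}
    (hp : p ∈ MvPolynomial.vanishingIdeal K (affineCone K χ)) (m : ℕ) :
    MvPolynomial.homogeneousComponent m p ∈ MvPolynomial.vanishingIdeal K (affineCone K χ) := by
  rcases lt_or_ge p.totalDegree m with hm | hm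
  · rw [MvPolynomial.homogeneousComponent_eq_zero _ _ hm]; exact Ideal.zero_mem _
  rw [mem_vanishingIdeal_affineCone] at *
  rintro ⟨c, t⟩
  set q : Polynomial K := ∑ i ∈ Finset.range (p.totalDegree + 1),
    Polynomial.monomial i (MvPolynomial.eval (torusMap K χ (c, t))
          (MvPolynomial.homogeneousComponent i p)) with hq
  have h0 : q = 0 := by
    refine Polynomial.eq_zero_of_infinite_isRoot q ?_
    refine Set.Infinite.mono (s := {(0 : K)}ᶜ) ?_ (Set.finite_singleton (0 : K)).infinite_compl
    intro b hb
    have := hp (Units.mk0 b hb * c, t)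
    rw [eval_torusMap_mul] at this
    simp only [Set.mem_ofPred_eq, Polynomial.IsRoot.def, hq, Polynomial.eval_finsetSum,
      Polynomial.eval_monomial]
    rw [← this]
    exact Finset.sum_congr rfl fun i _ => mul_comm _ _
  have h1 : q.coeff m = 0 := by rw [h0]; simp
  rw [hq, Polynomial.finsetSum_coeff] at h1
  simpa [Polynomial.coeff_monomial, Nat.lt_succ_iff, hm] using h1

end Toric

/-! ### The quasi-valuation induced by a weighting matrix -/

section Weight

variable {K : Type*} [Field K] {d r N : ℕ}

/-- The weight `Ψ · α ∈ ℚ^N` of the monomial `x^α`, in `ℚ^N` with the lexicographic order in which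
the first (top) coordinate is the most significant one. -/
def monWeight (Ψ : Matrix (Fin N) (Fin r) ℚ) (α : Fin r →₀ ℕ) : Lex (Fin N → ℚ) :=
  toLex (Ψ.mulVec fun j => (α j : ℚ))

/-- The valuation on the polynomial ring with weighting matrix `Ψ`: the minimum of the weights of
the monomials that occur (and `⊤` for the zero polynomial). -/
def polyVal (Ψ : Matrix (Fin N) (Fin r) ℚ) (p : MvPolynomial (Fin r) K) :
    WithTop (Lex (Fin N → ℚ)) :=
  p.support.inf fun α => (monWeight Ψ α : WithTop (Lex (Fin N → ℚ)))

variable {Ψ : Matrix (Fin N) (Fin r) ℚ}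

theorem polyVal_mono {p q : MvPolynomial (Fin r) K} (h : q.support ⊆ p.support) :
    polyVal Ψ p ≤ polyVal Ψ q := Finset.inf_mono h

theorem polyVal_eq_top {p : MvPolynomial (Fin r) K} (h : polyVal Ψ p = ⊤) : p = 0 := by
  by_contra hp
  obtain ⟨α, hα⟩ := MvPolynomial.support_nonempty.2 hp
  have : polyVal Ψ p ≤ monWeight Ψ α := Finset.inf_le hα
  rw [h, top_le_iff] at this
  exact WithTop.coe_ne_top this

theorem polyVal_add (p q : MvPolynomial (Fin r) K) :
    min (polyVal Ψ p) (polyVal Ψ q) ≤ polyVal Ψ (p + q) := by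
  classical
  refine le_trans ?_ (Finset.inf_mono MvPolynomial.support_add)
  rw [Finset.inf_union]
  exact le_rfl

theorem monWeight_add (α β : Fin r →₀ ℕ) :
    monWeight Ψ (α + β) = monWeight Ψ α + monWeight Ψ β := by
  have : (fun j => (((α + β) j : ℕ) : ℚ)) = (fun j => (α j : ℚ)) + fun j => (β j : ℚ) := by
    ext; simp
  rw [monWeight, this, Matrix.mulVec_add]; rfl

theorem polyVal_mul (p q : MvPolynomial (Fin r) K) :
    polyVal Ψ p + polyVal Ψ q ≤ polyVal Ψ (p * q) := by
  classical
  refine le_trans ?_ (Finset.inf_mono (MvPolynomial.support_mul p q))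
  refine Finset.le_inf fun γ hγ => ?_
  obtain ⟨α, hα, β, hβ, rfl⟩ := Finset.mem_add.1 hγ
  rw [monWeight_add, WithTop.coe_add]
  exact add_le_add (Finset.inf_le hα) (Finset.inf_le hβ)

theorem polyVal_one : polyVal Ψ (1 : MvPolynomial (Fin r) K) = 0 := by
  have : (1 : MvPolynomial (Fin r) K).support = {0} := by
    classical
    rw [← MvPolynomial.C_1, MvPolynomial.C_apply, MvPolynomial.support_monomial, if_neg one_ne_zero]
  rw [polyVal, this, Finset.inf_singleton, monWeight]
  have h : (fun j => (((0 : Fin r →₀ ℕ) j : ℕ) : ℚ)) = 0 := by ext; simp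
  rw [h, Matrix.mulVec_zero]; rfl

theorem polyVal_smul_le (c : K) (p : MvPolynomial (Fin r) K) :
    polyVal Ψ p ≤ polyVal Ψ (c • p) := polyVal_mono MvPolynomial.support_smul

variable [Infinite K] (χ : Fin r → Fin d → ℤ)

/-- The maximum of `polyVal Ψ` over all polynomials that restrict to a given function `f` on the
affine cone is attained. -/
theorem exists_isGreatest_polyVal (Ψ : Matrix (Fin N) (Fin r) ℚ) (f : CoordRing K χ) :
    ∃ a, IsGreatest {a | ∃ p, restr K χ p = f ∧ polyVal Ψ p = a} a := by
  classical
  obtain ⟨p₀, hp₀⟩ := Ideal.Quotient.mkₐ_surjective K _ f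
  set D := p₀.totalDegree
  let T : MvPolynomial (Fin r) K → MvPolynomial (Fin r) K := fun p =>
    ∑ i ∈ Finset.range (D + 1), MvPolynomial.homogeneousComponent i p
  have hTc : ∀ p α, (T p).coeff α = if α.degree < D + 1 then p.coeff α else 0 := by
    intro p α
    simp only [T, MvPolynomial.coeff_sum, MvPolynomial.coeff_homogeneousComponent]
    rw [Finset.sum_ite_eq]
    simp
  have hT0 : T p₀ = p₀ := MvPolynomial.sum_homogeneousComponent p₀
  have hTf : ∀ p, restr K χ p = f → restr K χ (T p) = f := by
    intro p hp
    have h1 : p - p₀ ∈ MvPolynomial.vanishingIdeal K (affineCone K χ) :=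
      Ideal.Quotient.eq.1 (hp.trans hp₀.symm)
    have h2 : T p - T p₀ ∈ MvPolynomial.vanishingIdeal K (affineCone K χ) := by
      have : T p - T p₀ =
          ∑ i ∈ Finset.range (D + 1), MvPolynomial.homogeneousComponent i (p - p₀) := by
        simp [T, Finset.sum_sub_distrib]
      rw [this]
      exact Ideal.sum_mem _ fun i _ => homogeneousComponent_mem h1 i
    rw [hT0] at h2
    exact (Ideal.Quotient.eq.2 h2).trans hp₀
  have hTs : ∀ p, (T p).support ⊆ p.support := by
    intro p α
    rw [MvPolynomial.mem_support_iff, MvPolynomial.mem_support_iff, hTc]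
    split_ifs <;> simp
  have hfin : {a | ∃ p, restr K χ p = f ∧ polyVal Ψ (T p) = a}.Finite := by
    have hα : {α : Fin r →₀ ℕ | α.degree < D + 1}.Finite := by
      simpa [Nat.lt_succ_iff] using Finsupp.finite_of_degree_le (σ := Fin r) D
    refine ((hα.image fun α => (monWeight Ψ α : WithTop (Lex (Fin N → ℚ)))).insert ⊤).subset ?_
    rintro _ ⟨p, -, rfl⟩
    rcases (T p).support.eq_empty_or_nonempty with h | h
    · left; simp [polyVal, h]
    · right
      obtain ⟨α, hα, h⟩ := Finset.exists_mem_eq_inf _ h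
        (fun α => (monWeight Ψ α : WithTop (Lex (Fin N → ℚ))))
      refine ⟨α, ?_, h.symm⟩
      rw [MvPolynomial.mem_support_iff, hTc] at hα
      by_contra hc
      exact hα (if_neg hc)
  obtain ⟨_, ⟨p, hp, rfl⟩, hmax⟩ := Set.exists_max_image _ id hfin ⟨_, p₀, hp₀, rfl⟩
  refine ⟨polyVal Ψ (T p), ⟨T p, hTf p hp, rfl⟩, ?_⟩
  rintro _ ⟨q, hq, rfl⟩
  exact (polyVal_mono (hTs q)).trans (hmax _ ⟨q, hq, rfl⟩)

/-- `ν_Ψ f`, the maximum of `polyVal Ψ p` over all polynomials `p` restricting to `f`. -/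
def nuFun (Ψ : Matrix (Fin N) (Fin r) ℚ) (f : CoordRing K χ) : WithTop (Lex (Fin N → ℚ)) :=
  Classical.choose (exists_isGreatest_polyVal χ Ψ f)

theorem nuFun_isGreatest (Ψ : Matrix (Fin N) (Fin r) ℚ) (f : CoordRing K χ) :
    IsGreatest {a | ∃ p, restr K χ p = f ∧ polyVal Ψ p = a} (nuFun χ Ψ f) :=
  Classical.choose_spec (exists_isGreatest_polyVal χ Ψ f)

variable {χ}

theorem le_nuFun (p : MvPolynomial (Fin r) K) : polyVal Ψ p ≤ nuFun χ Ψ (restr K χ p) :=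
  (nuFun_isGreatest χ Ψ _).2 ⟨p, rfl, rfl⟩

theorem exists_nuFun (f : CoordRing K χ) : ∃ p, restr K χ p = f ∧ polyVal Ψ p = nuFun χ Ψ f :=
  (nuFun_isGreatest χ Ψ f).1

theorem nuFun_eq_top (f : CoordRing K χ) : nuFun χ Ψ f = ⊤ ↔ f = 0 := by
  constructor
  · intro h
    obtain ⟨p, rfl, hp⟩ := exists_nuFun (Ψ := Ψ) f
    rw [polyVal_eq_top (hp.trans h), map_zero]
  · rintro rfl
    have := le_nuFun (χ := χ) (Ψ := Ψ) (0 : MvPolynomial (Fin r) K)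
    rw [map_zero] at this
    exact top_le_iff.1 (le_trans (by simp [polyVal]) this)

theorem nuFun_mul (f g : CoordRing K χ) :
    nuFun χ Ψ f + nuFun χ Ψ g ≤ nuFun χ Ψ (f * g) := by
  obtain ⟨p, rfl, hp⟩ := exists_nuFun (Ψ := Ψ) f
  obtain ⟨q, rfl, hq⟩ := exists_nuFun (Ψ := Ψ) g
  rw [← hp, ← hq, ← map_mul]
  exact (polyVal_mul p q).trans (le_nuFun _)

theorem nuFun_smul_le (c : K) (f : CoordRing K χ) : nuFun χ Ψ f ≤ nuFun χ Ψ (c • f) := by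
  obtain ⟨p, rfl, hp⟩ := exists_nuFun (Ψ := Ψ) f
  rw [← hp, ← map_smul]
  exact (polyVal_smul_le c p).trans (le_nuFun _)

theorem nuFun_one : nuFun χ Ψ (1 : CoordRing K χ) = 0 := by
  have h1 : (1 : CoordRing K χ) ≠ 0 := by
    intro h
    have h : restr K χ 1 = restr K χ 0 := by rw [map_one, map_zero]; exact h
    have h2 := Ideal.Quotient.eq.1 h
    rw [sub_zero, mem_vanishingIdeal_affineCone] at h2
    simpa using h2 1
  have h2 : 0 ≤ nuFun χ Ψ (1 : CoordRing K χ) := by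
    have := le_nuFun (χ := χ) (Ψ := Ψ) (1 : MvPolynomial (Fin r) K)
    rwa [map_one, polyVal_one] at this
  have h3 := nuFun_mul (Ψ := Ψ) (1 : CoordRing K χ) 1
  rw [mul_one] at h3
  refine le_antisymm ?_ h2
  have h4 : nuFun χ Ψ (1 : CoordRing K χ) ≠ ⊤ := fun h => h1 ((nuFun_eq_top _).1 h)
  obtain ⟨a, ha⟩ := WithTop.ne_top_iff_exists.1 h4
  rw [← ha, ← WithTop.coe_add, WithTop.coe_le_coe] at h3
  rw [← ha]
  exact WithTop.coe_le_coe.2 (by simpa using h3)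

variable (χ)

/-- The quasi-valuation `ν_Ψ` on the coordinate ring of the affine cone, the push-forward of the
valuation `polyVal Ψ` of the polynomial ring. -/
def nu (Ψ : Matrix (Fin N) (Fin r) ℚ) :
    QuasiValuation K (CoordRing K χ) (Lex (Fin N → ℚ)) where
  toFun := nuFun χ Ψ
  map_eq_top_iff := nuFun_eq_top
  map_one := nuFun_one
  min_le_map_add f g := by
    obtain ⟨p, rfl, hp⟩ := exists_nuFun (Ψ := Ψ) f
    obtain ⟨q, rfl, hq⟩ := exists_nuFun (Ψ := Ψ) g
    rw [← hp, ← hq, ← map_add]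
    exact (polyVal_add p q).trans (le_nuFun _)
  map_smul c f hc := by
    refine le_antisymm ?_ (nuFun_smul_le c f)
    have := nuFun_smul_le (Ψ := Ψ) c⁻¹ (c • f)
    rwa [smul_smul, inv_mul_cancel₀ hc, one_smul] at this
  add_le_map_mul := nuFun_mul

end Weight

/-! ### Polytopal subdivisions and GKZ-cones -/

section Subdivision

variable {d r : ℕ}

/-- The points of the configuration, in `ℝ^d`. -/
def pt (χ : Fin r → Fin d → ℤ) (i : Fin r) : Fin d → ℝ := fun j => (χ i j : ℝ)

/-- The convex hull of the points with index in `I`. -/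
def polytope (χ : Fin r → Fin d → ℤ) (I : Set (Fin r)) : Set (Fin d → ℝ) :=
  convexHull ℝ (pt χ '' I)

/-- A polytopal subdivision of the marked polytope `(P, A)`, `A = {χ₁, …, χᵣ}`, `P = conv A`, by
marked polytopes `(Q_I, A_I)`. As `Q_I = conv A_I`, a marked polytope is given by (the set of
indices of) its marking. Faces of a polytope are its exposed faces, among them the polytope itself
and, in the convention of `IsExposed`, the empty set. -/
structure PolytopalSubdivision (χ : Fin r → Fin d → ℤ) where
  cells : Finset (Finset (Fin r))
  full_dim : ∀ I ∈ cells, affineSpan ℝ (pt χ '' (I : Set (Fin r))) = ⊤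
  cover : ⋃ I ∈ cells, polytope χ (I : Set (Fin r)) = polytope χ Set.univ
  inter_face : ∀ I ∈ cells, ∀ J ∈ cells, I ≠ J →
    IsExposed ℝ (polytope χ (I : Set (Fin r)))
      (polytope χ (I : Set (Fin r)) ∩ polytope χ (J : Set (Fin r)))
  inter_marking : ∀ I ∈ cells, ∀ J ∈ cells, I ≠ J → ∀ k,
    pt χ k ∈ polytope χ (I : Set (Fin r)) ∩ polytope χ (J : Set (Fin r)) → (k ∈ I ↔ k ∈ J)

/-- A triangulation: every `Q_I` is a simplex with set of vertices `A_I`. -/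
def PolytopalSubdivision.IsTriangulation {χ : Fin r → Fin d → ℤ}
    (Q : PolytopalSubdivision χ) : Prop :=
  ∀ I ∈ Q.cells, AffineIndependent ℝ fun k : I => pt χ k

/-- The indices of the points that are marked in some polytope of the subdivision. -/
def PolytopalSubdivision.IsMarked {χ : Fin r → Fin d → ℤ} (Q : PolytopalSubdivision χ)
    (k : Fin r) : Prop :=
  ∃ I ∈ Q.cells, k ∈ I

/-- The embedding `ℝ^d → ℝ × ℝ^d`, `x ↦ (1, x)`. -/
def lift (x : Fin d → ℝ) : ℝ × (Fin d → ℝ) := (1, x)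

/-- The cone over a subset `D` of `ℝ^d ≅ {1} × ℝ^d`, i.e. the union of the rays through its points.
For a nonempty convex set this is the convex cone generated by it. -/
def coneOver (D : Set (Fin d → ℝ)) : Set (ℝ × (Fin d → ℝ)) :=
  {y | ∃ t : ℝ, 0 ≤ t ∧ ∃ x ∈ D, y = t • lift x}

variable {N : ℕ}

/-- `g` is linear on the cone over `D`. -/
def LinearOnCone (g : ℝ × (Fin d → ℝ) → Fin N → ℝ) (D : Set (Fin d → ℝ)) : Prop :=
  ∃ φ : ℝ × (Fin d → ℝ) →ₗ[ℝ] (Fin N → ℝ), Set.EqOn g φ (coneOver D)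

/-- `g`, as a map on the cone over the polytope `P`, is linear on the cones over the polytopes of
the subdivision. -/
def IsPiecewiseLinear {χ : Fin r → Fin d → ℤ} (Q : PolytopalSubdivision χ)
    (g : ℝ × (Fin d → ℝ) → Fin N → ℝ) : Prop :=
  ∀ I ∈ Q.cells, LinearOnCone g (polytope χ (I : Set (Fin r)))

/-- `g` is continuous and convex upward on `C`, for the lexicographic order on `ℝ^N`. -/
def IsConvexUpward (C : Set (ℝ × (Fin d → ℝ))) (g : ℝ × (Fin d → ℝ) → Fin N → ℝ) : Prop :=
  ContinuousOn g C ∧ ∀ u ∈ C, ∀ v ∈ C, ∀ t : ℝ, 0 ≤ t → t ≤ 1 →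
    toLex (t • g u + (1 - t) • g v) ≤ toLex (g (t • u + (1 - t) • v))

/-- `D` is a domain in `P`: the closure of a nonempty connected (relatively) open subset. -/
def IsDomainIn (P D : Set (Fin d → ℝ)) : Prop :=
  ∃ O : Set (Fin d → ℝ), IsOpen O ∧ IsConnected (O ∩ P) ∧ closure (O ∩ P) = D

/-- `D` is a domain of linearity of `g`: a maximal domain in `P` such that `g` is linear on the
cone over it. -/
def IsDomainOfLinearity (P : Set (Fin d → ℝ)) (g : ℝ × (Fin d → ℝ) → Fin N → ℝ)
    (D : Set (Fin d → ℝ)) : Prop :=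
  Maximal (fun D => IsDomainIn P D ∧ LinearOnCone g D) D

/-- The map `g` realises `Ψ` as a point of the closed GKZ-cone of `Q`: it is `Q`-piecewise linear
and convex upward, `g v = Ψ v` for the marked points and `g v ≥ Ψ v` for the others. -/
structure Realizes {χ : Fin r → Fin d → ℤ} (Q : PolytopalSubdivision χ)
    (Ψ : Matrix (Fin N) (Fin r) ℝ) (g : ℝ × (Fin d → ℝ) → Fin N → ℝ) : Prop where
  piecewiseLinear : IsPiecewiseLinear Q g
  convexUpward : IsConvexUpward (coneOver (polytope χ Set.univ)) g
  eq_of_marked : ∀ k, Q.IsMarked k → g (lift (pt χ k)) = Ψ.col k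
  le_of_not_marked : ∀ k, ¬ Q.IsMarked k → toLex (Ψ.col k) ≤ toLex (g (lift (pt χ k)))

/-- The closed GKZ-cone of `Q`. -/
def closedGKZCone {χ : Fin r → Fin d → ℤ} (Q : PolytopalSubdivision χ) (N : ℕ) :
    Set (Matrix (Fin N) (Fin r) ℝ) :=
  {Ψ | ∃ g, Realizes Q Ψ g}

/-- The open GKZ-cone `C(Q, N)`: the map `g` (which is unique on the cone over `P`) has the polytopes
of `Q` as its domains of linearity, and a point of `A` in such a polytope is marked there precisely
if `g` and `Ψ` agree on it. -/
def openGKZCone {χ : Fin r → Fin d → ℤ} (Q : PolytopalSubdivision χ) (N : ℕ) :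
    Set (Matrix (Fin N) (Fin r) ℝ) :=
  {Ψ | ∃ g, Realizes Q Ψ g ∧
    (∀ D, IsDomainOfLinearity (polytope χ Set.univ) g D ↔
      ∃ I ∈ Q.cells, D = polytope χ (I : Set (Fin r))) ∧
    ∀ I ∈ Q.cells, ∀ k, k ∈ I ↔
      pt χ k ∈ polytope χ (I : Set (Fin r)) ∧ g (lift (pt χ k)) = Ψ.col k}

end Subdivision

/-! ### Stanley–Reisner algebras -/

/-- The Stanley–Reisner ideal of a simplicial complex, generated by the squarefree monomials of the
non-faces. -/
def stanleyReisnerIdeal (K : Type*) [Field K] {V : Type*} (Δ : AbstractSimplicialComplex V) :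
    Ideal (MvPolynomial V K) :=
  Ideal.span {p | ∃ F : Finset V, F.Nonempty ∧ F ∉ Δ.faces ∧ p = ∏ i ∈ F, MvPolynomial.X i}

/-- The Stanley–Reisner algebra of a simplicial complex. -/
abbrev StanleyReisner (K : Type*) [Field K] {V : Type*} (Δ : AbstractSimplicialComplex V) :
    Type _ :=
  MvPolynomial V K ⧸ stanleyReisnerIdeal K Δ

/-- The simplicial complex of a triangulation: its vertices are the marked points, and its faces
are the nonempty sets of vertices of a common simplex. -/
def PolytopalSubdivision.complex {d r : ℕ} {χ : Fin r → Fin d → ℤ} (T : PolytopalSubdivision χ) :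
    AbstractSimplicialComplex {k : Fin r // T.IsMarked k} where
  faces := {F | F.Nonempty ∧ ∃ I ∈ T.cells, ∀ k ∈ F, k.1 ∈ I}
  isRelLowerSet_faces := by
    rintro F ⟨hF, I, hI, h⟩
    exact ⟨hF, fun G hG hGn => ⟨hGn, I, hI, fun k hk => h k (hG hk)⟩⟩
  singleton_mem := by
    rintro ⟨k, I, hI, hk⟩
    exact ⟨Finset.singleton_nonempty _, I, hI, by simpa using hk⟩

end GKZ

end

/-!
Put `G = ℤ × ℤ^d`. Restricting polynomials to the torus embeds `K[X̂_A]` into the group algebra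
`K[G]` (`coordToLaurent`, by linear independence of characters), and sends the monomial `x^α` to the
character with exponent `torusExp χ α = (|α|, ∑ αₖ χₖ)`.

All that is used about the point `Ψ` of the open GKZ-cone is a linear map `φ_I` for every simplex `I`
of the triangulation: it satisfies `Ψ(χₖ) ≤ φ_I(χₖ)` for all `k`, with equality precisely for the
vertices `k ∈ I` (`exists_supporting_linearMap`). It is the linear extension of the piece of `g` on
`I`. By concavity `g ≤ φ_I`; the set where `g = φ_I` is closed and convex with nonempty interior,
hence a domain on which `g` is linear, and so it is not larger than the domain of linearity given by
the simplex. By additivity, `Ψ · α ≤ φ_I(torusExp χ α)` for every `α`, with equality precisely if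
`x^α` is a monomial in the vertices of `I` (`Supports.monWeight_eq_iff`).

The associated graded algebra is spanned by the classes of the monomials `x^α` in degree `Ψ · α`
(`toGr_surjective`). A nonconstant monomial whose variables do not lie in a common simplex is
nilpotent (`isNilpotent_grMonomial`): the triangulation covers `P` and the barycentric coordinates
of a rational point in a lattice simplex are rational, so a power `x^{mα}` restricts to the same
function as a monomial `x^β` in the vertices of a simplex `I` (`exists_cell_of_multiple`), and
`Ψ · β = φ_I(torusExp χ β) = φ_I(torusExp χ (mα)) > Ψ · mα`. So the Stanley–Reisner algebra maps
onto the reduced algebra.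

For injectivity, taking initial forms with respect to the weight `φ_I` is a homomorphism
`grToLaurent` from the associated graded algebra to the domain `K[G]`. It keeps the monomials in the
vertices of `I` and kills the other ones. As the vertices of a simplex are linearly independent at
height one, different monomials in the vertices of `I` have different images, and hence a polynomial
that maps to a nilpotent element contains no monomial that is supported on a simplex, i.e. it lies in
the Stanley–Reisner ideal (`ker_toRedGr`).
-/

noncomputable section

namespace GKZ

/-! ### The lexicographic order on `ℝ^N` -/

theorem toLex_smul_lt {N : ℕ} {t : ℝ} (ht : 0 < t) {u v : Fin N → ℝ} (h : toLex u < toLex v) :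
    toLex (t • u) < toLex (t • v) := by
  obtain ⟨i, hi, hlt⟩ := h
  refine ⟨i, fun j hj => ?_, ?_⟩
  · have : u j = v j := hi j hj
    change t * u j = t * v j
    rw [this]
  · exact mul_lt_mul_of_pos_left hlt ht

theorem toLex_smul_le_iff {N : ℕ} {t : ℝ} (ht : 0 < t) {u v : Fin N → ℝ} :
    toLex (t • u) ≤ toLex (t • v) ↔ toLex u ≤ toLex v := by
  constructor
  · intro h
    by_contra hc
    exact absurd (toLex_smul_lt ht (not_le.1 hc)) (not_lt.2 h)
  · intro h
    rcases h.eq_or_lt with h | h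
    · rw [toLex.injective h]
    · exact (toLex_smul_lt ht h).le

/-- The inclusion of `ℚ^N` into `ℝ^N`, both with the lexicographic order. -/
def castLex (N : ℕ) : Lex (Fin N → ℚ) →+ Lex (Fin N → ℝ) where
  toFun a := toLex fun i => ((ofLex a i : ℚ) : ℝ)
  map_zero' := by
    apply ofLex.injective
    funext i
    exact Rat.cast_zero
  map_add' a b := by
    apply ofLex.injective
    funext i
    exact Rat.cast_add _ _

theorem castLex_strictMono (N : ℕ) : StrictMono (castLex N) := by
  rintro a b ⟨i, hi, hlt⟩
  refine ⟨i, fun j hj => ?_, ?_⟩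
  · exact congrArg (fun q : ℚ => (q : ℝ)) (hi j hj)
  · exact Rat.cast_lt.2 hlt

/-! ### Supporting linear maps of the cells -/

section Geometry

variable {d r N : ℕ} {χ : Fin r → Fin d → ℤ}

theorem lift_combo (x y : Fin d → ℝ) (t : ℝ) :
    lift (t • x + (1 - t) • y) = t • lift x + (1 - t) • lift y := by
  simp [lift]

theorem lift_mem_coneOver {D : Set (Fin d → ℝ)} {x : Fin d → ℝ} (hx : x ∈ D) :
    lift x ∈ coneOver D := ⟨1, zero_le_one, x, hx, (one_smul _ _).symm⟩

theorem continuous_lift : Continuous (lift : (Fin d → ℝ) → ℝ × (Fin d → ℝ)) :=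
  continuous_const.prodMk continuous_id

theorem isClosed_polytope (I : Set (Fin r)) : IsClosed (polytope χ I) :=
  ((Set.toFinite _).isCompact_convexHull ℝ).isClosed

/-- A map that is convex upward on the cone over `P` lies below each of its linear pieces, provided
the domain `Q` of the piece is full-dimensional: a point of `P` and an interior point of `Q` can be
extended to a segment that ends in `Q`. -/
theorem IsConvexUpward.le_of_linearOn {P Q : Set (Fin d → ℝ)} {g : ℝ × (Fin d → ℝ) → Fin N → ℝ}
    (hg : IsConvexUpward (coneOver P) g) (hQP : Q ⊆ P) (hint : (interior Q).Nonempty)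
    {φ : ℝ × (Fin d → ℝ) →ₗ[ℝ] (Fin N → ℝ)} (hφ : Set.EqOn g φ (coneOver Q))
    {y : Fin d → ℝ} (hy : y ∈ P) : toLex (g (lift y)) ≤ toLex (φ (lift y)) := by
  obtain ⟨z, hz⟩ := hint
  have hev : ∀ᶠ ε in nhdsWithin (0 : ℝ) (Set.Ioi 0), z + ε • (z - y) ∈ Q := by
    have hc : Filter.Tendsto (fun ε : ℝ => z + ε • (z - y)) (nhds 0) (nhds z) := by
      have : Continuous fun ε : ℝ => z + ε • (z - y) := by fun_prop
      simpa using this.tendsto 0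
    exact (hc.eventually (mem_interior_iff_mem_nhds.1 hz)).filter_mono nhdsWithin_le_nhds
  obtain ⟨ε, hεQ, hε⟩ := (hev.and self_mem_nhdsWithin).exists
  have hε : 0 < ε := hε
  set t : ℝ := ε / (1 + ε) with ht
  have ht0 : 0 < t := by positivity
  have ht1 : t ≤ 1 := by rw [ht, div_le_one (by positivity)]; linarith
  have hzt : t • y + (1 - t) • (z + ε • (z - y)) = z := by
    ext i
    simp only [Pi.add_apply, Pi.smul_apply, Pi.sub_apply, smul_eq_mul, ht]
    field_simp
    ring
  have h1 := hg.2 _ (lift_mem_coneOver hy) _ (lift_mem_coneOver (hQP hεQ)) t ht0.le ht1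
  rw [← lift_combo, hzt, hφ (lift_mem_coneOver (interior_subset hz)),
    hφ (lift_mem_coneOver hεQ)] at h1
  have h2 : φ (lift z) = t • φ (lift y) + (1 - t) • φ (lift (z + ε • (z - y))) := by
    rw [← map_smul, ← map_smul, ← map_add, ← lift_combo, hzt]
  rw [h2, toLex_add, toLex_add, add_le_add_iff_right] at h1
  exact (toLex_smul_le_iff ht0).1 h1

theorem polytope_subset_univ (I : Set (Fin r)) : polytope χ I ⊆ polytope χ Set.univ :=
  convexHull_mono (Set.image_mono (Set.subset_univ I))

theorem PolytopalSubdivision.exists_cell (T : PolytopalSubdivision χ) {x : Fin d → ℝ}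
    (hx : x ∈ polytope χ Set.univ) : ∃ I ∈ T.cells, x ∈ polytope χ (I : Set (Fin r)) := by
  rw [← T.cover] at hx
  simpa using hx

theorem PolytopalSubdivision.interior_nonempty (T : PolytopalSubdivision χ) {I : Finset (Fin r)}
    (hI : I ∈ T.cells) : (interior (polytope χ (I : Set (Fin r)))).Nonempty :=
  interior_convexHull_nonempty_iff_affineSpan_eq_top.2 (T.full_dim I hI)

theorem IsPiecewiseLinear.map_smul_lift {T : PolytopalSubdivision χ}
    {g : ℝ × (Fin d → ℝ) → Fin N → ℝ} (hg : IsPiecewiseLinear T g) {x : Fin d → ℝ}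
    (hx : x ∈ polytope χ Set.univ) {t : ℝ} (ht : 0 ≤ t) : g (t • lift x) = t • g (lift x) := by
  obtain ⟨I, hI, hxI⟩ := T.exists_cell hx
  obtain ⟨φ, hφ⟩ := hg I hI
  rw [hφ ⟨t, ht, x, hxI, rfl⟩, hφ (lift_mem_coneOver hxI), map_smul]

/-- The contact set of `g` with the linear extension of its piece on a domain of linearity is not
larger than that domain. It is closed and convex, hence a domain, and `g` is linear on its cone. -/
theorem Realizes.mem_polytope_of_eq {T : PolytopalSubdivision χ} {Ψ : Matrix (Fin N) (Fin r) ℝ}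
    {g : ℝ × (Fin d → ℝ) → Fin N → ℝ} (hg : Realizes T Ψ g) {I : Finset (Fin r)}
    (hI : I ∈ T.cells)
    (hdom : IsDomainOfLinearity (polytope χ Set.univ) g (polytope χ (I : Set (Fin r))))
    {φ : ℝ × (Fin d → ℝ) →ₗ[ℝ] (Fin N → ℝ)}
    (hφ : Set.EqOn g φ (coneOver (polytope χ (I : Set (Fin r)))))
    {y : Fin d → ℝ} (hy : y ∈ polytope χ Set.univ) (hgy : g (lift y) = φ (lift y)) :
    y ∈ polytope χ (I : Set (Fin r)) := by
  set P := polytope χ Set.univ with hP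
  have hPc : Convex ℝ P := convex_convexHull ℝ _
  set D : Set (Fin d → ℝ) := {x | x ∈ P ∧ g (lift x) = φ (lift x)} with hD
  have hDP : D ⊆ P := fun x hx => hx.1
  have hQD : polytope χ (I : Set (Fin r)) ⊆ D := fun x hx =>
    ⟨polytope_subset_univ _ hx, hφ (lift_mem_coneOver hx)⟩
  have hle : ∀ x ∈ P, toLex (g (lift x)) ≤ toLex (φ (lift x)) := fun x hx =>
    hg.convexUpward.le_of_linearOn (polytope_subset_univ _) (T.interior_nonempty hI) hφ hx
  have hDc : Convex ℝ D := by
    intro x hx x' hx' a b ha hb hab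
    obtain rfl : b = 1 - a := by linarith
    have hmem := hPc hx.1 hx'.1 ha hb hab
    refine ⟨hmem, ?_⟩
    have h1 := hg.convexUpward.2 _ (lift_mem_coneOver hx.1) _ (lift_mem_coneOver hx'.1) a ha
      (by linarith)
    rw [hx.2, hx'.2, ← map_smul, ← map_smul, ← map_add, ← lift_combo] at h1
    exact toLex.injective (le_antisymm (hle _ hmem) h1)
  have hDcl : IsClosed D := by
    have hgc : ContinuousOn (fun x => g (lift x)) P :=
      hg.convexUpward.1.comp continuous_lift.continuousOn fun x hx => lift_mem_coneOver hx
    have hφc : ContinuousOn (fun x => φ (lift x)) P :=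
      (φ.continuous_of_finiteDimensional.comp continuous_lift).continuousOn
    have := (hgc.sub hφc).preimage_isClosed_of_isClosed (isClosed_polytope _)
      (isClosed_singleton (x := (0 : Fin N → ℝ)))
    convert this using 1
    ext x
    simp [hD, hP, sub_eq_zero]
  have hDi : (interior D).Nonempty := (T.interior_nonempty hI).mono (interior_mono hQD)
  refine hdom.2 ⟨⟨interior D, isOpen_interior, ?_, ?_⟩, φ, ?_⟩ hQD ⟨hy, hgy⟩
  · rw [Set.inter_eq_left.2 (interior_subset.trans hDP)]
    exact ⟨hDi, hDc.interior.isPreconnected⟩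
  · rw [Set.inter_eq_left.2 (interior_subset.trans hDP),
      hDc.closure_interior_eq_closure_of_nonempty_interior hDi, hDcl.closure_eq]
  · rintro _ ⟨t, ht, x, hx, rfl⟩
    rw [hg.piecewiseLinear.map_smul_lift hx.1 ht, hx.2, map_smul]

/-- Each cell of a subdivision whose open GKZ-cone contains `Ψ` has a linear map that lies above
`Ψ` at all points of the configuration and meets `Ψ` precisely at the marked points of the cell. -/
theorem exists_supporting_linearMap {T : PolytopalSubdivision χ} {Ψ : Matrix (Fin N) (Fin r) ℝ}
    (hΨ : Ψ ∈ openGKZCone T N) {I : Finset (Fin r)} (hI : I ∈ T.cells) :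
    ∃ φ : ℝ × (Fin d → ℝ) →ₗ[ℝ] (Fin N → ℝ), ∀ k,
      toLex (Ψ.col k) ≤ toLex (φ (lift (pt χ k))) ∧ (Ψ.col k = φ (lift (pt χ k)) ↔ k ∈ I) := by
  obtain ⟨g, hg, hdom, hmark⟩ := hΨ
  obtain ⟨φ, hφ⟩ := hg.piecewiseLinear I hI
  refine ⟨φ, fun k => ?_⟩
  have hk : pt χ k ∈ polytope χ Set.univ :=
    subset_convexHull ℝ _ (Set.mem_image_of_mem _ (Set.mem_univ k))
  have h1 : toLex (Ψ.col k) ≤ toLex (g (lift (pt χ k))) := by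
    by_cases h : T.IsMarked k
    · rw [hg.eq_of_marked k h]
    · exact hg.le_of_not_marked k h
  have h2 := hg.convexUpward.le_of_linearOn (polytope_subset_univ _) (T.interior_nonempty hI) hφ hk
  refine ⟨h1.trans h2, fun h => ?_, fun h => ?_⟩
  · have h3 : g (lift (pt χ k)) = Ψ.col k :=
      toLex.injective (le_antisymm (h2.trans (by rw [h])) h1)
    exact (hmark I hI k).2 ⟨hg.mem_polytope_of_eq hI ((hdom _).2 ⟨I, hI, rfl⟩) hφ hk
      (h3.trans h), h3⟩
  · obtain ⟨h3, h4⟩ := (hmark I hI k).1 h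
    rw [← h4, hφ (lift_mem_coneOver h3)]

end Geometry

/-! ### Exponents of the torus and their weights -/

section Exponents

variable {d r N : ℕ} (χ : Fin r → Fin d → ℤ)

/-- The exponent `(|α|, ∑ₖ αₖ χₖ)` of the character of the torus that is the restriction of the
monomial `x^α`. -/
def torusExp : (Fin r →₀ ℕ) →+ ℤ × (Fin d → ℤ) :=
  Finsupp.liftAddHom fun k => (multiplesHom _ ((1, χ k) : ℤ × (Fin d → ℤ)))

theorem torusExp_apply (α : Fin r →₀ ℕ) :
    torusExp χ α = ∑ k, α k • ((1, χ k) : ℤ × (Fin d → ℤ)) := by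
  rw [torusExp, Finsupp.liftAddHom_apply, Finsupp.sum_fintype] <;> simp

/-- The inclusion of the lattice of exponents into `ℝ × ℝ^d`. -/
def castExp (d : ℕ) : ℤ × (Fin d → ℤ) →+ ℝ × (Fin d → ℝ) where
  toFun s := (s.1, fun j => s.2 j)
  map_zero' := by ext <;> simp
  map_add' s t := by ext <;> simp

theorem castExp_injective : Function.Injective (castExp d) := by
  intro s t h
  have h1 := congrArg Prod.fst h
  have h2 := fun j => congrFun (congrArg Prod.snd h) j
  ext j
  · exact Int.cast_injective h1
  · exact Int.cast_injective (h2 j)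

theorem castExp_one (k : Fin r) : castExp d (1, χ k) = lift (pt χ k) := by
  ext <;> simp [castExp, lift, pt]

theorem castExp_torusExp (α : Fin r →₀ ℕ) :
    castExp d (torusExp χ α) = ∑ k, (α k : ℝ) • lift (pt χ k) := by
  rw [torusExp_apply, map_sum]
  refine Finset.sum_congr rfl fun k _ => ?_
  rw [map_nsmul, castExp_one, Nat.cast_smul_eq_nsmul]

theorem monWeight_zero (Ψ : Matrix (Fin N) (Fin r) ℚ) : monWeight Ψ 0 = 0 := by
  simpa using monWeight_add (Ψ := Ψ) 0 0

theorem monWeight_eq_sum (Ψ : Matrix (Fin N) (Fin r) ℚ) (α : Fin r →₀ ℕ) :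
    monWeight Ψ α = ∑ k, α k • monWeight Ψ (Finsupp.single k 1) := by
  let w : (Fin r →₀ ℕ) →+ Lex (Fin N → ℚ) :=
    { toFun := monWeight Ψ
      map_zero' := monWeight_zero Ψ
      map_add' := monWeight_add }
  change w α = ∑ k, α k • w (Finsupp.single k 1)
  conv_lhs => rw [← Finsupp.sum_single α, Finsupp.sum_fintype _ _ (by simp), map_sum]
  refine Finset.sum_congr rfl fun k _ => ?_
  rw [← map_nsmul, Finsupp.smul_single, smul_eq_mul, mul_one]

theorem castLex_monWeight_single (Ψ : Matrix (Fin N) (Fin r) ℚ) (k : Fin r) :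
    castLex N (monWeight Ψ (Finsupp.single k 1)) =
      toLex ((Ψ.map fun q : ℚ => (q : ℝ)).col k) := by
  apply ofLex.injective
  funext i
  simp [castLex, monWeight, Matrix.mulVec, dotProduct, Finsupp.single_apply]

variable {χ}

/-- The additive weight `ψ` on exponents supports the marking `I`: it bounds the weight of every
variable from above, with equality precisely for the variables with index in `I`. -/
def Supports (χ : Fin r → Fin d → ℤ) (Ψ : Matrix (Fin N) (Fin r) ℚ)
    (ψ : ℤ × (Fin d → ℤ) →+ Lex (Fin N → ℝ)) (I : Finset (Fin r)) : Prop :=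
  ∀ k, castLex N (monWeight Ψ (Finsupp.single k 1)) ≤ ψ (1, χ k) ∧
    (castLex N (monWeight Ψ (Finsupp.single k 1)) = ψ (1, χ k) ↔ k ∈ I)

variable {Ψ : Matrix (Fin N) (Fin r) ℚ} {ψ : ℤ × (Fin d → ℤ) →+ Lex (Fin N → ℝ)}
  {I : Finset (Fin r)}

theorem exists_supports {T : PolytopalSubdivision χ}
    (hΨ : Ψ.map (fun q : ℚ => (q : ℝ)) ∈ openGKZCone T N) (hI : I ∈ T.cells) :
    ∃ ψ, Supports χ Ψ ψ I := by
  obtain ⟨φ, hφ⟩ := exists_supporting_linearMap hΨ hI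
  let ψ : ℤ × (Fin d → ℤ) →+ Lex (Fin N → ℝ) :=
    { toFun := fun s => toLex (φ (castExp d s))
      map_zero' := by rw [map_zero, map_zero]; rfl
      map_add' := fun s t => by rw [map_add, map_add]; rfl }
  refine ⟨ψ, fun k => ?_⟩
  have h : ψ (1, χ k) = toLex (φ (lift (pt χ k))) := by rw [← castExp_one]; rfl
  rw [h, castLex_monWeight_single, toLex_inj]
  exact hφ k

theorem Supports.monWeight_le (h : Supports χ Ψ ψ I) (α : Fin r →₀ ℕ) :
    castLex N (monWeight Ψ α) ≤ ψ (torusExp χ α) := by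
  rw [monWeight_eq_sum, torusExp_apply, map_sum, map_sum]
  refine Finset.sum_le_sum fun k _ => ?_
  rw [map_nsmul, map_nsmul]
  exact nsmul_le_nsmul_right (h k).1 _

theorem Supports.monWeight_eq_iff (h : Supports χ Ψ ψ I) (α : Fin r →₀ ℕ) :
    castLex N (monWeight Ψ α) = ψ (torusExp χ α) ↔ α.support ⊆ I := by
  rw [monWeight_eq_sum, torusExp_apply, map_sum, map_sum, Finset.sum_eq_sum_iff_of_le]
  · refine ⟨fun H k hk => ?_, fun H k _ => ?_⟩
    · have := H k (Finset.mem_univ k)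
      rw [map_nsmul, map_nsmul] at this
      exact (h k).2.1 (nsmul_right_injective (Finsupp.mem_support_iff.1 hk) this)
    · rw [map_nsmul, map_nsmul]
      by_cases hk : α k = 0
      · rw [hk, zero_smul, zero_smul]
      · rw [(h k).2.2 (H (Finsupp.mem_support_iff.2 hk))]
  · intro k _
    rw [map_nsmul, map_nsmul]
    exact nsmul_le_nsmul_right (h k).1 _

/-- The points of a simplex are linearly independent after the embedding `x ↦ (1, x)`. -/
theorem eq_of_sum_smul_lift_eq {χ : Fin r → Fin d → ℤ} {I : Finset (Fin r)}
    (hI : AffineIndependent ℝ fun k : I => pt χ k) {c c' : Fin r → ℝ}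
    (h : ∑ k ∈ I, c k • lift (pt χ k) = ∑ k ∈ I, c' k • lift (pt χ k)) :
    ∀ k ∈ I, c k = c' k := by
  have h0 : ∑ k ∈ I, (c k - c' k) • lift (pt χ k) = 0 := by
    simp only [sub_smul, Finset.sum_sub_distrib, h, sub_self]
  have h1 : ∑ k ∈ I, (c k - c' k) = 0 := by
    have := congrArg Prod.fst h0
    simpa [lift, Prod.fst_sum] using this
  have h2 : ∑ k ∈ I, (c k - c' k) • pt χ k = 0 := by
    have := congrArg Prod.snd h0
    simpa [lift, Prod.snd_sum] using this
  rw [← Finset.sum_attach] at h1 h2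
  intro k hk
  have := affineIndependent_iff.1 hI Finset.univ (fun k => c k - c' k) h1 h2 ⟨k, hk⟩
    (Finset.mem_univ _)
  exact sub_eq_zero.1 this

theorem sum_smul_lift_eq_of_support_subset {α : Fin r →₀ ℕ} (hα : α.support ⊆ I) :
    castExp d (torusExp χ α) = ∑ k ∈ I, (α k : ℝ) • lift (pt χ k) := by
  rw [castExp_torusExp]
  refine (Finset.sum_subset (Finset.subset_univ I) fun k _ hk => ?_).symm
  rw [Finsupp.notMem_support_iff.1 fun h => hk (hα h)]
  simp

theorem torusExp_injOn (hI : AffineIndependent ℝ fun k : I => pt χ k) {α β : Fin r →₀ ℕ}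
    (hα : α.support ⊆ I) (hβ : β.support ⊆ I) (h : torusExp χ α = torusExp χ β) : α = β := by
  have h1 := congrArg (castExp d) h
  rw [sum_smul_lift_eq_of_support_subset hα, sum_smul_lift_eq_of_support_subset hβ] at h1
  ext k
  by_cases hk : k ∈ I
  · exact_mod_cast eq_of_sum_smul_lift_eq hI h1 k hk
  · rw [Finsupp.notMem_support_iff.1 fun h => hk (hα h),
      Finsupp.notMem_support_iff.1 fun h => hk (hβ h)]

/-- A lattice point that is a real linear combination of the vertices of a lattice simplex has
rational coefficients. -/
theorem exists_rat_of_sum_smul_lift_eq (hI : AffineIndependent ℝ fun k : I => pt χ k)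
    {c : Fin r → ℝ} {s : ℤ × (Fin d → ℤ)}
    (h : castExp d s = ∑ k ∈ I, c k • lift (pt χ k)) : ∀ k ∈ I, ∃ q : ℚ, c k = q := by
  -- A `ℚ`-linear retraction `π` of `ℝ` onto `ℚ` turns `c` into another family of coefficients.
  obtain ⟨π, hπ⟩ := LinearMap.exists_leftInverse_of_injective (Algebra.linearMap ℚ ℝ)
    (LinearMap.ker_eq_bot.2 (algebraMap ℚ ℝ).injective)
  have hπq : ∀ q : ℚ, π (q : ℝ) = q := fun q => LinearMap.congr_fun hπ q
  have hπz : ∀ (x : ℝ) (n : ℤ), π (x * n) = π x * n := fun x n => by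
    rw [mul_comm, ← zsmul_eq_mul, map_zsmul, zsmul_eq_mul, mul_comm]
  have hπs : ∀ n : ℤ, π (n : ℝ) = n := fun n => by simpa using hπq n
  have h' : castExp d s = ∑ k ∈ I, ((π (c k) : ℚ) : ℝ) • lift (pt χ k) := by
    have h1 := congrArg Prod.fst h
    have h2 := fun j => congrFun (congrArg Prod.snd h) j
    ext j
    · have := congrArg (fun x => ((π x : ℚ) : ℝ)) h1
      simpa [castExp, lift, Prod.fst_sum, hπs] using this
    · have := congrArg (fun x => ((π x : ℚ) : ℝ)) (h2 j)
      simpa [castExp, lift, pt, Prod.snd_sum, hπs, hπz] using this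
  exact fun k hk => ⟨π (c k), eq_of_sum_smul_lift_eq hI (h.symm.trans h') k hk⟩

/-- Some positive multiple of any nonzero exponent lies in the monoid generated by the vertices of
one of the simplices of a triangulation. -/
theorem exists_cell_of_multiple {T : PolytopalSubdivision χ} (hT : T.IsTriangulation)
    {α : Fin r →₀ ℕ} (hα : α ≠ 0) :
    ∃ I ∈ T.cells, ∃ m : ℕ, 0 < m ∧ ∃ β : Fin r →₀ ℕ, β.support ⊆ I ∧
      torusExp χ β = torusExp χ (m • α) := by
  classical
  set n : ℝ := ∑ k, (α k : ℝ) with hn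
  have hn0 : 0 < n := by
    obtain ⟨k, hk⟩ := Finsupp.ne_iff.1 hα
    refine Finset.sum_pos' (fun _ _ => by positivity) ⟨k, Finset.mem_univ k, ?_⟩
    exact_mod_cast Nat.pos_of_ne_zero hk
  set x : Fin d → ℝ := ∑ k, (α k / n) • pt χ k with hx
  have hxP : x ∈ polytope χ Set.univ := by
    refine (convex_convexHull ℝ _).sum_mem (fun k _ => by positivity) ?_ fun k _ =>
      subset_convexHull ℝ _ (Set.mem_image_of_mem _ (Set.mem_univ k))
    rw [← Finset.sum_div, div_self hn0.ne']
  have hxα : castExp d (torusExp χ α) = n • lift x := by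
    rw [castExp_torusExp]
    ext j
    · simp [lift, Prod.fst_sum, hn]
    · simp only [lift, Prod.snd_sum, Prod.smul_snd, Finset.sum_apply, Pi.smul_apply, smul_eq_mul,
        hx, Finset.mul_sum]
      exact Finset.sum_congr rfl fun k _ => by field_simp
  obtain ⟨I, hI, hxI⟩ := T.exists_cell hxP
  obtain ⟨c, hc0, hc1, hcx⟩ : ∃ c : Fin r → ℝ, (∀ k ∈ I, 0 ≤ c k) ∧ ∑ k ∈ I, c k = 1 ∧
      ∑ k ∈ I, c k • pt χ k = x := by
    have hinj : Set.InjOn (pt χ) I := fun k hk l hl hkl => by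
      have := (hT I hI).injective (a₁ := ⟨k, hk⟩) (a₂ := ⟨l, hl⟩) hkl
      exact congrArg Subtype.val this
    rw [polytope, ← Finset.coe_image, Finset.mem_convexHull'] at hxI
    obtain ⟨w, hw0, hw1, hwx⟩ := hxI
    rw [Finset.sum_image hinj] at hw1 hwx
    exact ⟨fun k => w (pt χ k), fun k hk => hw0 _ (Finset.mem_image_of_mem _ hk), hw1, hwx⟩
  have hcα : castExp d (torusExp χ α) = ∑ k ∈ I, (n * c k) • lift (pt χ k) := by
    rw [hxα]
    ext j
    · simp [lift, Prod.fst_sum, ← Finset.mul_sum, hc1]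
    · simp [lift, Prod.snd_sum, ← hcx, Finset.mul_sum, mul_assoc]
  choose! q hq using exists_rat_of_sum_smul_lift_eq (hT I hI) hcα
  have hq0 : ∀ k ∈ I, 0 ≤ q k := fun k hk => by
    have : (0 : ℝ) ≤ q k := by rw [← hq k hk]; exact mul_nonneg hn0.le (hc0 k hk)
    exact_mod_cast this
  -- `m` is a common denominator of the coefficients.
  set m : ℕ := ∏ k ∈ I, (q k).den with hm
  have hnat : ∀ k ∈ I, ∃ b : ℕ, (b : ℚ) = m * q k := fun k hk => by
    obtain ⟨e, he⟩ : (q k).den ∣ m := Finset.dvd_prod_of_mem _ hk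
    refine ⟨e * (q k).num.toNat, ?_⟩
    have h1 : (((q k).num.toNat : ℤ) : ℚ) = (q k).num := by
      rw [Int.toNat_of_nonneg (Rat.num_nonneg.2 (hq0 k hk))]
    have h2 : ((q k).den : ℚ) * q k = (q k).num := Rat.den_mul_eq_num _
    push_cast at h1
    rw [he]
    push_cast
    rw [h1, ← h2]
    ring
  choose! b hb using hnat
  refine ⟨I, hI, m, Finset.prod_pos fun k _ => (q k).den_pos,
    Finsupp.onFinset I (fun k => if k ∈ I then b k else 0) (by intro k; simp; tauto), ?_, ?_⟩
  · exact Finsupp.support_onFinset_subset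
  · apply castExp_injective
    rw [sum_smul_lift_eq_of_support_subset Finsupp.support_onFinset_subset, map_nsmul, map_nsmul,
      hcα, Finset.smul_sum]
    refine Finset.sum_congr rfl fun k hk => ?_
    rw [Finsupp.onFinset_apply, if_pos hk, hq k hk, ← Nat.cast_smul_eq_nsmul ℝ, smul_smul]
    congr 1
    exact_mod_cast hb k hk

end Exponents

/-! ### The coordinate ring as a subring of the Laurent polynomials -/

section Laurent

variable {K : Type*} [Field K] {d r N : ℕ} (χ : Fin r → Fin d → ℤ)

variable (K) in
/-- The pull-back of polynomial functions along the parametrisation `torusMap` of the cone, with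
values in the Laurent polynomials, i.e. the group algebra of the character lattice of the torus. -/
def toLaurent : MvPolynomial (Fin r) K →ₐ[K] AddMonoidAlgebra K (ℤ × (Fin d → ℤ)) :=
  MvPolynomial.aeval fun k => AddMonoidAlgebra.single (1, χ k) 1

theorem toLaurent_monomial (α : Fin r →₀ ℕ) (c : K) :
    toLaurent K χ (MvPolynomial.monomial α c) = AddMonoidAlgebra.single (torusExp χ α) c := by
  rw [toLaurent, MvPolynomial.aeval_monomial, torusExp_apply, Finsupp.prod_fintype _ _ (by simp)]
  have h : ∀ s : Finset (Fin r), ∏ k ∈ s, (AddMonoidAlgebra.single ((1, χ k) : ℤ × (Fin d → ℤ))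
      (1 : K)) ^ α k = AddMonoidAlgebra.single (∑ k ∈ s, α k • ((1, χ k) : ℤ × (Fin d → ℤ))) 1 := by
    classical
    intro s
    induction s using Finset.induction_on with
    | empty => simp [AddMonoidAlgebra.one_def]
    | insert k s hk ih =>
      rw [Finset.prod_insert hk, Finset.sum_insert hk, ih, AddMonoidAlgebra.single_pow,
        AddMonoidAlgebra.single_mul_single, one_pow, one_mul]
  rw [h, ← Algebra.smul_def, AddMonoidAlgebra.smul_single, smul_eq_mul, mul_one]

theorem toLaurent_eq_sum (p : MvPolynomial (Fin r) K) :
    toLaurent K χ p = ∑ α ∈ p.support, AddMonoidAlgebra.single (torusExp χ α) (p.coeff α) := by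
  conv_lhs => rw [p.as_sum, map_sum]
  exact Finset.sum_congr rfl fun α _ => toLaurent_monomial χ α _

theorem exists_of_mem_support_toLaurent {p : MvPolynomial (Fin r) K} {s : ℤ × (Fin d → ℤ)}
    (hs : s ∈ (toLaurent K χ p).coeff.support) : ∃ α ∈ p.support, torusExp χ α = s := by
  classical
  by_contra! h
  rw [Finsupp.mem_support_iff, toLaurent_eq_sum, AddMonoidAlgebra.coeff_sum,
    Finsupp.finsetSum_apply] at hs
  refine hs (Finset.sum_eq_zero fun α hα => ?_)
  rw [AddMonoidAlgebra.coeff_single, Finsupp.single_apply, if_neg (h α hα)]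

/-- The character of the torus `K* × (K*)^d` with the given exponent. -/
def character (K : Type*) [Field K] {d : ℕ} (s : ℤ × (Fin d → ℤ)) :
    Kˣ × (Fin d → Kˣ) →* K where
  toFun t := ((t.1 ^ s.1 * ∏ j, t.2 j ^ s.2 j : Kˣ) : K)
  map_one' := by simp
  map_mul' t u := by
    rw [← Units.val_mul]
    congr 1
    simp only [Prod.fst_mul, Prod.snd_mul, Pi.mul_apply, mul_zpow, Finset.prod_mul_distrib]
    exact mul_mul_mul_comm _ _ _ _

theorem character_injective [CharZero K] : Function.Injective (character K (d := d)) := by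
  classical
  -- The powers of `2` tell integers apart in characteristic zero.
  have hinj : ∀ m n : ℤ, (Units.mk0 (2 : K) two_ne_zero) ^ m = Units.mk0 2 two_ne_zero ^ n →
      m = n := by
    intro m n h
    have h1 : (((2 : ℚ) ^ m : ℚ) : K) = ((2 : ℚ) ^ n : ℚ) := by
      have := congrArg Units.val h
      push_cast at this ⊢
      simpa using this
    exact zpow_right_injective₀ (by norm_num) (by norm_num) (Rat.cast_injective h1)
  intro s s' h
  have h1 : ∀ t : Kˣ × (Fin d → Kˣ),
      t.1 ^ s.1 * ∏ j, t.2 j ^ s.2 j = t.1 ^ s'.1 * ∏ j, t.2 j ^ s'.2 j :=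
    fun t => Units.ext (DFunLike.congr_fun h t)
  ext j
  · have := h1 (Units.mk0 2 two_ne_zero, 1)
    exact hinj _ _ (by simpa using this)
  · have := h1 (1, Pi.mulSingle j (Units.mk0 2 two_ne_zero))
    refine hinj _ _ ?_
    simp only [one_zpow, one_mul] at this
    rw [Finset.prod_eq_single j, Finset.prod_eq_single j] at this
    · simpa using this
    all_goals simp +contextual [Pi.mulSingle_eq_of_ne]

/-- Evaluation of Laurent polynomials at a point of the torus. -/
def evalTorus (t : Kˣ × (Fin d → Kˣ)) : AddMonoidAlgebra K (ℤ × (Fin d → ℤ)) →ₐ[K] K :=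
  AddMonoidAlgebra.lift K K _
    { toFun := fun s => character K (Multiplicative.toAdd s) t
      map_one' := by simp [character]
      map_mul' := fun s s' => by
        simp only [character, MonoidHom.coe_mk, OneHom.coe_mk, toAdd_mul, Prod.fst_add,
          Prod.snd_add, Pi.add_apply, zpow_add, Finset.prod_mul_distrib, ← Units.val_mul]
        rw [mul_mul_mul_comm] }

theorem evalTorus_single (t : Kˣ × (Fin d → Kˣ)) (s : ℤ × (Fin d → ℤ)) (c : K) :
    evalTorus t (AddMonoidAlgebra.single s c) = c * character K s t := by
  rw [evalTorus, AddMonoidAlgebra.lift_single]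
  rfl

variable {χ}

theorem evalTorus_toLaurent (t : Kˣ × (Fin d → Kˣ)) (p : MvPolynomial (Fin r) K) :
    evalTorus t (toLaurent K χ p) = MvPolynomial.eval (torusMap K χ t) p := by
  have : (evalTorus t).comp (toLaurent K χ) = MvPolynomial.aeval (torusMap K χ t) := by
    ext k
    simp [toLaurent, evalTorus_single, character, torusMap]
  rw [← MvPolynomial.aeval_eq_eval, ← this]
  rfl

/-- A Laurent polynomial that vanishes on the torus is zero, by Dedekind's linear independence of
characters. -/
theorem eq_zero_of_evalTorus [CharZero K] {x : AddMonoidAlgebra K (ℤ × (Fin d → ℤ))}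
    (h : ∀ t, evalTorus t x = 0) : x = 0 := by
  have hli := (linearIndependent_monoidHom (Kˣ × (Fin d → Kˣ)) K).comp _
    (character_injective (K := K) (d := d))
  refine AddMonoidAlgebra.ext ((linearIndependent_iff.1 hli) x.coeff ?_)
  funext t
  rw [Finsupp.linearCombination_apply, Finsupp.sum, Finset.sum_apply, Pi.zero_apply, ← h t]
  conv_rhs => rw [← AddMonoidAlgebra.sum_coeff_single x, Finsupp.sum, map_sum]
  exact Finset.sum_congr rfl fun s _ => by rw [evalTorus_single]; rfl

theorem mem_vanishingIdeal_iff_toLaurent [CharZero K] {p : MvPolynomial (Fin r) K} :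
    p ∈ MvPolynomial.vanishingIdeal K (affineCone K χ) ↔ toLaurent K χ p = 0 := by
  rw [mem_vanishingIdeal_affineCone]
  simp only [← evalTorus_toLaurent]
  exact ⟨eq_zero_of_evalTorus, fun h t => by rw [h, map_zero]⟩

theorem restr_monomial_eq [CharZero K] {α β : Fin r →₀ ℕ} (h : torusExp χ α = torusExp χ β) :
    restr K χ (MvPolynomial.monomial α 1) = restr K χ (MvPolynomial.monomial β 1) := by
  refine Ideal.Quotient.eq.2 (mem_vanishingIdeal_iff_toLaurent.2 ?_)
  rw [map_sub, toLaurent_monomial, toLaurent_monomial, h, sub_self]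

variable (K χ) in
/-- The embedding of the coordinate ring of the cone into the Laurent polynomials. -/
def coordToLaurent [CharZero K] : CoordRing K χ →ₐ[K] AddMonoidAlgebra K (ℤ × (Fin d → ℤ)) :=
  Ideal.Quotient.liftₐ _ (toLaurent K χ) fun _ => mem_vanishingIdeal_iff_toLaurent.1

theorem coordToLaurent_restr [CharZero K] (p : MvPolynomial (Fin r) K) :
    coordToLaurent K χ (restr K χ p) = toLaurent K χ p := rfl

/-! ### Initial forms of Laurent polynomials -/

section DegPart

variable {G Γ : Type*} [AddCommGroup G] [AddCommGroup Γ] [LinearOrder Γ]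

variable (K) in
/-- The part of weight `a` of an element of a group algebra, for an additive weight `ψ`. -/
def degPart (ψ : G →+ Γ) (a : Γ) : AddMonoidAlgebra K G →ₗ[K] AddMonoidAlgebra K G where
  toFun x := .ofCoeff (x.coeff.filter fun s => ψ s = a)
  map_add' x y := by ext; simp [Finsupp.filter_add]
  map_smul' c x := by ext; simp [Finsupp.filter_smul]

theorem degPart_single (ψ : G →+ Γ) (a : Γ) (s : G) (c : K) :
    degPart K ψ a (AddMonoidAlgebra.single s c) =
      if ψ s = a then AddMonoidAlgebra.single s c else 0 := by
  apply AddMonoidAlgebra.ext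
  change (Finsupp.single s c).filter (fun s => ψ s = a) = _
  split_ifs with h
  · rw [Finsupp.filter_single_of_pos (fun s => ψ s = a) h]; rfl
  · rw [Finsupp.filter_single_of_neg (fun s => ψ s = a) h]; rfl

theorem degPart_eq_zero (ψ : G →+ Γ) {a : Γ} {x : AddMonoidAlgebra K G}
    (hx : ∀ s ∈ x.coeff.support, a < ψ s) : degPart K ψ a x = 0 := by
  rw [← AddMonoidAlgebra.sum_coeff_single x, Finsupp.sum, map_sum]
  refine Finset.sum_eq_zero fun s hs => ?_
  rw [degPart_single, if_neg (hx s hs).ne']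

/-- Lowest parts multiply. -/
theorem degPart_mul [IsOrderedAddMonoid Γ] (ψ : G →+ Γ) {a b : Γ} {x y : AddMonoidAlgebra K G}
    (hx : ∀ s ∈ x.coeff.support, a ≤ ψ s) (hy : ∀ s ∈ y.coeff.support, b ≤ ψ s) :
    degPart K ψ (a + b) (x * y) = degPart K ψ a x * degPart K ψ b y := by
  conv_lhs => rw [← AddMonoidAlgebra.sum_coeff_single x, ← AddMonoidAlgebra.sum_coeff_single y]
  conv_rhs => rw [← AddMonoidAlgebra.sum_coeff_single x, ← AddMonoidAlgebra.sum_coeff_single y]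
  simp only [Finsupp.sum, Finset.sum_mul_sum, map_sum]
  refine Finset.sum_congr rfl fun s hs => Finset.sum_congr rfl fun t ht => ?_
  rw [AddMonoidAlgebra.single_mul_single, degPart_single, degPart_single, degPart_single, map_add]
  by_cases h1 : ψ s = a
  · by_cases h2 : ψ t = b
    · rw [if_pos (by rw [h1, h2]), if_pos h1, if_pos h2, AddMonoidAlgebra.single_mul_single]
    · rw [if_neg (by rw [h1, add_right_inj]; exact h2), if_neg h2, mul_zero]
  · rw [if_neg, if_neg h1, zero_mul]
    exact (add_lt_add_of_lt_of_le (lt_of_le_of_ne (hx s hs) (Ne.symm h1)) (hy t ht)).ne'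

end DegPart

end Laurent

/-! ### Monomials in the associated graded algebra -/

/-- The initial form of `f`, computed with any decidability instance for the equality of degrees. -/
theorem QuasiValuation.initialForm_eq_of {K R Γ : Type*} [Field K] [CommRing R] [Algebra K R]
    [AddCommGroup Γ] [LinearOrder Γ] [IsOrderedAddMonoid Γ] (ν : QuasiValuation K R Γ)
    [inst : DecidableEq Γ] {f : R} {a : Γ} (h : ν.toFun f = a) :
    ν.initialForm f = DirectSum.of ν.leaf a (ν.leafMk a f h.ge) := by
  have hdec : inst = fun a b => LinearOrder.toDecidableEq a b := Subsingleton.elim _ _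
  subst hdec
  have htop : ν.toFun f ≠ ⊤ := by rw [h]; exact WithTop.coe_ne_top
  have ha : (ν.toFun f).untop htop = a := by rw [← WithTop.coe_inj, WithTop.coe_untop, h]
  subst ha
  rw [QuasiValuation.initialForm, dif_neg htop]

section Graded

theorem polyVal_monomial {K : Type*} [Field K] {r N : ℕ} (Ψ : Matrix (Fin N) (Fin r) ℚ)
    (α : Fin r →₀ ℕ) {c : K} (hc : c ≠ 0) :
    polyVal Ψ (MvPolynomial.monomial α c) = monWeight Ψ α := by
  classical
  rw [polyVal, MvPolynomial.support_monomial, if_neg hc, Finset.inf_singleton]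

variable {K : Type*} [Field K] [CharZero K] {d r N : ℕ} {χ : Fin r → Fin d → ℤ}
  (Ψ : Matrix (Fin N) (Fin r) ℚ)

variable {Ψ} in
theorem mem_geSub_of_le {α : Fin r →₀ ℕ} {a : Lex (Fin N → ℚ)} (h : a ≤ monWeight Ψ α) :
    restr K χ (MvPolynomial.monomial α 1) ∈ (nu (K := K) χ Ψ).geSub a := by
  refine le_trans ?_ (le_nuFun _)
  rw [polyVal_monomial Ψ α one_ne_zero]
  exact WithTop.coe_le_coe.2 h

variable {Ψ} in
theorem mem_gtSub_of_lt {α : Fin r →₀ ℕ} {a : Lex (Fin N → ℚ)} (h : a < monWeight Ψ α) :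
    restr K χ (MvPolynomial.monomial α 1) ∈ (nu (K := K) χ Ψ).gtSub a := by
  refine lt_of_lt_of_le ?_ (le_nuFun _)
  rw [polyVal_monomial Ψ α one_ne_zero]
  exact WithTop.coe_lt_coe.2 h

variable (K χ) in
/-- The class of the monomial `x^α` in the leaf of degree `Ψ · α`. It is zero if the quasi-valuation
of the restriction of `x^α` exceeds `Ψ · α`. -/
def grMonomial (α : Fin r →₀ ℕ) : (nu (K := K) χ Ψ).gr :=
  DirectSum.of (nu (K := K) χ Ψ).leaf (monWeight Ψ α)
    ((nu (K := K) χ Ψ).leafMk _ (restr K χ (MvPolynomial.monomial α 1)) (mem_geSub_of_le le_rfl))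

theorem of_leafMk_eq {a b : Lex (Fin N → ℚ)} {x y : CoordRing K χ}
    (hx : x ∈ (nu (K := K) χ Ψ).geSub a) (hy : y ∈ (nu (K := K) χ Ψ).geSub b)
    (hab : a = b) (hxy : x = y) :
    DirectSum.of (nu (K := K) χ Ψ).leaf a ((nu (K := K) χ Ψ).leafMk a x hx) =
      DirectSum.of (nu (K := K) χ Ψ).leaf b ((nu (K := K) χ Ψ).leafMk b y hy) := by
  subst hab; subst hxy; rfl

theorem grMonomial_zero : grMonomial K χ Ψ 0 = 1 := by
  refine of_leafMk_eq Ψ _ (nu (K := K) χ Ψ).one_mem_geSub (monWeight_zero Ψ) ?_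
  exact map_one (restr K χ)

theorem grMonomial_add (α β : Fin r →₀ ℕ) :
    grMonomial K χ Ψ (α + β) = grMonomial K χ Ψ α * grMonomial K χ Ψ β := by
  rw [grMonomial, grMonomial, grMonomial, DirectSum.of_mul_of]
  refine of_leafMk_eq Ψ _ ((nu (K := K) χ Ψ).mul_mem_geSub (mem_geSub_of_le le_rfl)
    (mem_geSub_of_le le_rfl)) (monWeight_add α β) ?_
  rw [← map_mul, MvPolynomial.monomial_mul, one_mul]

variable (K χ) in
/-- The map `α ↦ grMonomial K χ Ψ α` as a homomorphism of monoids. -/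
def grMonomialHom : Multiplicative (Fin r →₀ ℕ) →* (nu (K := K) χ Ψ).gr where
  toFun α := grMonomial K χ Ψ (Multiplicative.toAdd α)
  map_one' := grMonomial_zero Ψ
  map_mul' _ _ := grMonomial_add Ψ _ _

theorem grMonomial_nsmul (m : ℕ) (α : Fin r →₀ ℕ) :
    grMonomial K χ Ψ (m • α) = grMonomial K χ Ψ α ^ m :=
  map_pow (grMonomialHom K χ Ψ) (Multiplicative.ofAdd α) m

variable (K χ) in
/-- The presentation of the associated graded algebra as a quotient of the polynomial ring. -/
def toGr : MvPolynomial (Fin r) K →ₐ[K] (nu (K := K) χ Ψ).gr :=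
  MvPolynomial.aeval fun k => grMonomial K χ Ψ (Finsupp.single k 1)

theorem toGr_monomial (α : Fin r →₀ ℕ) (c : K) :
    toGr K χ Ψ (MvPolynomial.monomial α c) = c • grMonomial K χ Ψ α := by
  rw [toGr, MvPolynomial.aeval_monomial, ← Algebra.smul_def]
  congr 1
  conv_rhs => rw [← Finsupp.sum_single α]
  have h : ∀ s : Finset (Fin r), ∏ k ∈ s, grMonomial K χ Ψ (Finsupp.single k 1) ^ α k =
      grMonomial K χ Ψ (∑ k ∈ s, Finsupp.single k (α k)) := by
    classical
    intro s
    induction s using Finset.induction_on with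
    | empty => simp [grMonomial_zero]
    | insert k s hk ih =>
      rw [Finset.prod_insert hk, Finset.sum_insert hk, ih, grMonomial_add, ← grMonomial_nsmul]
      simp
  exact h _

/-- The associated graded algebra is spanned by the classes of monomials: a polynomial that attains
`ν_Ψ f` has all its monomials in the filtration step of `f`. -/
theorem toGr_surjective : Function.Surjective (toGr K χ Ψ) := by
  intro z
  rw [← AlgHom.mem_range]
  induction z using DirectSum.induction_on with
  | zero => exact zero_mem _
  | add x y hx hy => exact add_mem hx hy
  | of a x =>
    obtain ⟨f, hf, rfl⟩ := (nu (K := K) χ Ψ).exists_leafMk x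
    obtain ⟨p, rfl, hp⟩ := exists_nuFun (Ψ := Ψ) f
    have hα : ∀ α ∈ p.support, a ≤ monWeight Ψ α := fun α hα => by
      have h1 : (a : WithTop (Lex (Fin N → ℚ))) ≤ polyVal Ψ p := by rw [hp]; exact hf
      exact WithTop.coe_le_coe.1 (h1.trans (Finset.inf_le hα))
    have hsum : (nu (K := K) χ Ψ).leafMk a (restr K χ p) hf = ∑ α ∈ p.support.attach,
        p.coeff α.1 • (nu (K := K) χ Ψ).leafMk a (restr K χ (MvPolynomial.monomial α.1 1))
          (mem_geSub_of_le (hα α.1 α.2)) := by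
      rw [QuasiValuation.leafMk]
      simp only [← map_smul, ← map_sum]
      congr 1
      apply Subtype.ext
      rw [AddSubmonoidClass.coe_finsetSum]
      change restr K χ p = ∑ α ∈ p.support.attach,
        p.coeff α.1 • restr K χ (MvPolynomial.monomial α.1 1)
      rw [Finset.sum_attach p.support
        fun α => p.coeff α • restr K χ (MvPolynomial.monomial α 1)]
      conv_lhs => rw [p.as_sum, map_sum]
      refine Finset.sum_congr rfl fun α _ => ?_
      rw [← map_smul, MvPolynomial.smul_monomial, smul_eq_mul, mul_one]
    rw [hsum, map_sum]
    refine sum_mem fun α _ => ?_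
    rw [DirectSum.of_smul]
    refine Subalgebra.smul_mem _ ?_ _
    rcases (hα α.1 α.2).eq_or_lt with h | h
    · refine ⟨MvPolynomial.monomial α.1 1, ?_⟩
      change toGr K χ Ψ _ = _
      rw [toGr_monomial, one_smul]
      exact of_leafMk_eq Ψ _ _ h.symm rfl
    · rw [(nu (K := K) χ Ψ).leafMk_eq_zero _ (mem_gtSub_of_lt h), map_zero]
      exact zero_mem _

variable {Ψ}

theorem grMonomial_eq_zero {α β : Fin r →₀ ℕ} (h : torusExp χ α = torusExp χ β)
    (hlt : monWeight Ψ α < monWeight Ψ β) : grMonomial K χ Ψ α = 0 := by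
  rw [grMonomial, (nu (K := K) χ Ψ).leafMk_eq_zero, map_zero]
  rw [restr_monomial_eq h]
  exact mem_gtSub_of_lt hlt

/-- A monomial whose variables do not belong to a common simplex is nilpotent in the associated
graded algebra: a power of it equals, on the cone, a monomial in the vertices of a simplex, and that
monomial has larger weight. -/
theorem isNilpotent_grMonomial {T : PolytopalSubdivision χ} (hT : T.IsTriangulation)
    (hΨ : Ψ.map (fun q : ℚ => (q : ℝ)) ∈ openGKZCone T N) {α : Fin r →₀ ℕ} (hα0 : α ≠ 0)
    (hα : ∀ I ∈ T.cells, ¬ α.support ⊆ I) : IsNilpotent (grMonomial K χ Ψ α) := by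
  obtain ⟨I, hI, m, hm, β, hβ, hβα⟩ := exists_cell_of_multiple hT hα0
  obtain ⟨ψ, hψ⟩ := exists_supports hΨ hI
  refine ⟨m, ?_⟩
  rw [← grMonomial_nsmul]
  refine grMonomial_eq_zero hβα.symm ((castLex_strictMono N).lt_iff_lt.1 ?_)
  rw [(hψ.monWeight_eq_iff β).2 hβ, hβα]
  refine lt_of_le_of_ne (hψ.monWeight_le _) fun h => hα I hI ?_
  have := (hψ.monWeight_eq_iff _).1 h
  rwa [Finsupp.support_smul_eq hm.ne'] at this

/-! ### The components of the associated graded algebra -/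

variable {ψ : ℤ × (Fin d → ℤ) →+ Lex (Fin N → ℝ)} {I : Finset (Fin r)}

theorem Supports.le_of_mem_geSub (h : Supports χ Ψ ψ I) {a : Lex (Fin N → ℚ)} {f : CoordRing K χ}
    (hf : f ∈ (nu (K := K) χ Ψ).geSub a) {s : ℤ × (Fin d → ℤ)}
    (hs : s ∈ (coordToLaurent K χ f).coeff.support) : castLex N a ≤ ψ s := by
  obtain ⟨p, rfl, hp⟩ := exists_nuFun (Ψ := Ψ) f
  obtain ⟨α, hα, rfl⟩ := exists_of_mem_support_toLaurent χ hs
  have h1 : (a : WithTop (Lex (Fin N → ℚ))) ≤ polyVal Ψ p := by rw [hp]; exact hf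
  have h2 := WithTop.coe_le_coe.1 (h1.trans (Finset.inf_le hα))
  exact ((castLex_strictMono N).monotone h2).trans (h.monWeight_le α)

theorem Supports.lt_of_mem_gtSub (h : Supports χ Ψ ψ I) {a : Lex (Fin N → ℚ)} {f : CoordRing K χ}
    (hf : f ∈ (nu (K := K) χ Ψ).gtSub a) {s : ℤ × (Fin d → ℤ)}
    (hs : s ∈ (coordToLaurent K χ f).coeff.support) : castLex N a < ψ s := by
  obtain ⟨p, rfl, hp⟩ := exists_nuFun (Ψ := Ψ) f
  obtain ⟨α, hα, rfl⟩ := exists_of_mem_support_toLaurent χ hs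
  have h1 : (a : WithTop (Lex (Fin N → ℚ))) < polyVal Ψ p := by rw [hp]; exact hf
  have h2 := WithTop.coe_lt_coe.1 (h1.trans_le (Finset.inf_le hα))
  exact ((castLex_strictMono N) h2).trans_le (h.monWeight_le α)

/-- The map on a leaf that sends `f` to the part of weight `a` of its Laurent polynomial. -/
def leafToLaurent (h : Supports χ Ψ ψ I) (a : Lex (Fin N → ℚ)) :
    (nu (K := K) χ Ψ).leaf a →ₗ[K] AddMonoidAlgebra K (ℤ × (Fin d → ℤ)) :=
  Submodule.liftQ _ ((degPart K ψ (castLex N a)).comp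
      ((coordToLaurent K χ).toLinearMap.comp ((nu (K := K) χ Ψ).geSub a).subtype))
    fun _ hx => LinearMap.mem_ker.2 (degPart_eq_zero ψ fun _ hs => h.lt_of_mem_gtSub hx hs)

theorem leafToLaurent_mk (h : Supports χ Ψ ψ I) {a : Lex (Fin N → ℚ)} {f : CoordRing K χ}
    (hf : f ∈ (nu (K := K) χ Ψ).geSub a) :
    leafToLaurent h a ((nu (K := K) χ Ψ).leafMk a f hf) =
      degPart K ψ (castLex N a) (coordToLaurent K χ f) := rfl

/-- The homomorphism from the associated graded algebra to the Laurent polynomials that takes the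
initial form with respect to the linear weight of a simplex. It is the projection of the associated
graded algebra to the component that belongs to the simplex. -/
def grToLaurent (h : Supports χ Ψ ψ I) :
    (nu (K := K) χ Ψ).gr →ₐ[K] AddMonoidAlgebra K (ℤ × (Fin d → ℤ)) :=
  DirectSum.toAlgebra K (nu (K := K) χ Ψ).leaf (leafToLaurent h)
    (by
      refine (leafToLaurent_mk h (nu (K := K) χ Ψ).one_mem_geSub).trans ?_
      rw [map_one, AddMonoidAlgebra.one_def, degPart_single, map_zero, map_zero, if_pos rfl])
    (by
      intro a b x y
      obtain ⟨x, hx, rfl⟩ := (nu (K := K) χ Ψ).exists_leafMk x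
      obtain ⟨y, hy, rfl⟩ := (nu (K := K) χ Ψ).exists_leafMk y
      refine (leafToLaurent_mk h ((nu (K := K) χ Ψ).mul_mem_geSub hx hy)).trans ?_
      rw [leafToLaurent_mk, leafToLaurent_mk, map_mul, map_add]
      exact degPart_mul ψ (fun _ hs => h.le_of_mem_geSub hx hs)
        fun _ hs => h.le_of_mem_geSub hy hs)

theorem grToLaurent_grMonomial (h : Supports χ Ψ ψ I) (α : Fin r →₀ ℕ) [Decidable (α.support ⊆ I)] :
    grToLaurent h (grMonomial K χ Ψ α) =
      if α.support ⊆ I then AddMonoidAlgebra.single (torusExp χ α) 1 else 0 := by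
  classical
  have h1 : grToLaurent h (grMonomial K χ Ψ α) = leafToLaurent h (monWeight Ψ α)
      ((nu (K := K) χ Ψ).leafMk _ (restr K χ (MvPolynomial.monomial α 1))
        (mem_geSub_of_le le_rfl)) :=
    DirectSum.toAddMonoid_of (fun a => (leafToLaurent h a).toAddMonoidHom) _ _
  rw [h1, leafToLaurent_mk, coordToLaurent_restr, toLaurent_monomial, degPart_single]
  by_cases hα : α.support ⊆ I
  · rw [if_pos ((h.monWeight_eq_iff α).2 hα).symm, if_pos hα]
  · rw [if_neg fun e => hα ((h.monWeight_eq_iff α).1 e.symm), if_neg hα]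

/-- For a marked point the quasi-valuation of the corresponding coordinate function is the weight of
the variable. -/
theorem initialForm_restr_X {T : PolytopalSubdivision χ}
    (hΨ : Ψ.map (fun q : ℚ => (q : ℝ)) ∈ openGKZCone T N) {k : Fin r} (hk : T.IsMarked k) :
    (nu (K := K) χ Ψ).initialForm (restr K χ (MvPolynomial.X k)) =
      grMonomial K χ Ψ (Finsupp.single k 1) := by
  classical
  obtain ⟨I, hI, hkI⟩ := hk
  obtain ⟨ψ, hψ⟩ := exists_supports hΨ hI
  have hne : grMonomial K χ Ψ (Finsupp.single k 1) ≠ 0 := by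
    intro h0
    have h1 := grToLaurent_grMonomial (K := K) hψ (Finsupp.single k 1)
    rw [h0, map_zero, if_pos (Finsupp.support_single_subset.trans (by simpa using hkI))] at h1
    exact one_ne_zero (AddMonoidAlgebra.single_eq_zero.1 h1.symm)
  have hν : (nu (K := K) χ Ψ).toFun (restr K χ (MvPolynomial.X k)) =
      (monWeight Ψ (Finsupp.single k 1) : WithTop (Lex (Fin N → ℚ))) := by
    refine le_antisymm (not_lt.1 fun hlt => hne ?_) (mem_geSub_of_le (K := K) (χ := χ) le_rfl)
    rw [grMonomial, (nu (K := K) χ Ψ).leafMk_eq_zero, map_zero]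
    exact hlt
  exact (nu (K := K) χ Ψ).initialForm_eq_of hν

end Graded

/-! ### Comparison with the Stanley–Reisner algebra -/

section StanleyReisner

variable {K : Type*} [Field K] {d r N : ℕ} {χ : Fin r → Fin d → ℤ} {T : PolytopalSubdivision χ}

/-- The exponent of a monomial in the marked variables, as an exponent in all variables. -/
def extendExp (T : PolytopalSubdivision χ) (α : {k : Fin r // T.IsMarked k} →₀ ℕ) : Fin r →₀ ℕ :=
  α.mapDomain Subtype.val

theorem extendExp_injective : Function.Injective (extendExp T) :=
  Finsupp.mapDomain_injective Subtype.val_injective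

theorem support_extendExp_subset_iff {α : {k : Fin r // T.IsMarked k} →₀ ℕ}
    {I : Finset (Fin r)} : (extendExp T α).support ⊆ I ↔ ∀ k ∈ α.support, k.1 ∈ I := by
  classical
  rw [extendExp, Finsupp.mapDomain_support_of_injective Subtype.val_injective,
    Finset.image_subset_iff]

theorem cells_nonempty (hspan : affineSpan ℝ (Set.range (pt χ)) = ⊤) : T.cells.Nonempty := by
  have hne : (Set.range (pt χ)).Nonempty := by
    rw [← affineSpan_nonempty ℝ, hspan]
    exact Set.univ_nonempty
  obtain ⟨_, k, rfl⟩ := hne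
  obtain ⟨I, hI, -⟩ := T.exists_cell (subset_convexHull ℝ _ (Set.mem_image_of_mem _
    (Set.mem_univ k)))
  exact ⟨I, hI⟩

/-- The monomials that are not supported on a simplex lie in the Stanley–Reisner ideal. -/
theorem monomial_mem_stanleyReisnerIdeal {α : {k : Fin r // T.IsMarked k} →₀ ℕ} (hα0 : α ≠ 0)
    (hα : ∀ I ∈ T.cells, ¬ (extendExp T α).support ⊆ I) (c : K) :
    MvPolynomial.monomial α c ∈ stanleyReisnerIdeal K T.complex := by
  have hmem : ∏ k ∈ α.support, (MvPolynomial.X k : MvPolynomial _ K) ∈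
      stanleyReisnerIdeal K T.complex := by
    refine Ideal.subset_span ⟨α.support, Finsupp.support_nonempty_iff.2 hα0, ?_, rfl⟩
    rintro ⟨-, I, hI, h⟩
    exact hα I hI (support_extendExp_subset_iff.2 h)
  refine Ideal.mem_of_dvd _ ?_ hmem
  rw [MvPolynomial.monomial_eq]
  refine Dvd.dvd.mul_left (Finset.prod_dvd_prod_of_dvd _ _ fun k hk => ?_) _
  exact dvd_pow_self _ (Finsupp.mem_support_iff.1 hk)

variable [CharZero K] {Ψ : Matrix (Fin N) (Fin r) ℚ}

variable (K Ψ) in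
/-- The homomorphism that sends the variables of the Stanley–Reisner algebra to the classes of the
coordinate functions in the reduced associated graded algebra. -/
def toRedGr (T : PolytopalSubdivision χ) :
    MvPolynomial {k : Fin r // T.IsMarked k} K →ₐ[K] Red (nu (K := K) χ Ψ).gr :=
  (Ideal.Quotient.mkₐ K _).comp ((toGr K χ Ψ).comp (MvPolynomial.rename Subtype.val))

theorem toRedGr_monomial (α : {k : Fin r // T.IsMarked k} →₀ ℕ) (c : K) :
    toRedGr K Ψ T (MvPolynomial.monomial α c) =
      c • Ideal.Quotient.mk _ (grMonomial K χ Ψ (extendExp T α)) := by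
  change Ideal.Quotient.mkₐ K _ (toGr K χ Ψ (MvPolynomial.rename _ _)) = _
  rw [MvPolynomial.rename_monomial, toGr_monomial, map_smul]
  rfl

theorem toRedGr_surjective (hspan : affineSpan ℝ (Set.range (pt χ)) = ⊤)
    (hT : T.IsTriangulation) (hΨ : Ψ.map (fun q : ℚ => (q : ℝ)) ∈ openGKZCone T N) :
    Function.Surjective (toRedGr K Ψ T) := by
  intro z
  obtain ⟨z, rfl⟩ := Ideal.Quotient.mk_surjective z
  obtain ⟨p, rfl⟩ := toGr_surjective Ψ z
  rw [← AlgHom.mem_range]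
  change Ideal.Quotient.mkₐ K _ (toGr K χ Ψ p) ∈ _
  rw [p.as_sum, map_sum, map_sum]
  refine sum_mem fun α _ => ?_
  rw [toGr_monomial, map_smul]
  refine Subalgebra.smul_mem _ ?_ _
  by_cases hα : ∃ I ∈ T.cells, α.support ⊆ I
  · obtain ⟨I, hI, hαI⟩ := hα
    have hrange : ∀ k ∈ α.support, k ∈ Set.range (Subtype.val : {k // T.IsMarked k} → Fin r) :=
      fun k hk => ⟨⟨k, I, hI, hαI hk⟩, rfl⟩
    refine ⟨MvPolynomial.monomial (α.comapDomain Subtype.val Subtype.val_injective.injOn) 1, ?_⟩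
    refine (toRedGr_monomial _ _).trans ?_
    rw [one_smul, extendExp, Finsupp.mapDomain_comapDomain _ Subtype.val_injective _ hrange]
    rfl
  · push Not at hα
    have hα0 : α ≠ 0 := by
      rintro rfl
      obtain ⟨I, hI⟩ := cells_nonempty (T := T) hspan
      exact hα I hI (by simp)
    have : Ideal.Quotient.mkₐ K (nilradical _) (grMonomial K χ Ψ α) = 0 :=
      Ideal.Quotient.eq_zero_iff_mem.2 (isNilpotent_grMonomial hT hΨ hα0 hα)
    rw [this]
    exact zero_mem _

/-- The kernel is detected on the components: if `p` has a monomial supported on a simplex, the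
projection to the component of that simplex does not kill `p`. -/
theorem ker_toRedGr (hspan : affineSpan ℝ (Set.range (pt χ)) = ⊤)
    (hT : T.IsTriangulation) (hΨ : Ψ.map (fun q : ℚ => (q : ℝ)) ∈ openGKZCone T N) :
    RingHom.ker (toRedGr K Ψ T) = stanleyReisnerIdeal K T.complex := by
  classical
  apply le_antisymm
  · intro p hp
    have hp : IsNilpotent (toGr K χ Ψ (MvPolynomial.rename Subtype.val p)) :=
      Ideal.Quotient.eq_zero_iff_mem.1 (RingHom.mem_ker.1 hp)
    rw [p.as_sum]
    refine Ideal.sum_mem _ fun α hα => ?_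
    have hface : ∀ I ∈ T.cells, ¬ (extendExp T α).support ⊆ I := by
      intro I hI hαI
      obtain ⟨ψ, hψ⟩ := exists_supports hΨ hI
      have h0 : grToLaurent hψ (toGr K χ Ψ (MvPolynomial.rename Subtype.val p)) = 0 :=
        (hp.map (grToLaurent hψ)).eq_zero
      have h1 := congrArg (fun x => x.coeff (torusExp χ (extendExp T α))) h0
      rw [p.as_sum] at h1
      simp only [map_sum, MvPolynomial.rename_monomial, toGr_monomial, map_smul,
        AddMonoidAlgebra.coeff_sum, Finsupp.finsetSum_apply, AddMonoidAlgebra.coeff_zero,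
        Finsupp.zero_apply] at h1
      rw [Finset.sum_eq_single α] at h1
      · change (p.coeff α • grToLaurent hψ (grMonomial K χ Ψ (extendExp T α))).coeff _ = 0 at h1
        rw [grToLaurent_grMonomial, if_pos hαI, AddMonoidAlgebra.smul_single,
          AddMonoidAlgebra.coeff_single, Finsupp.single_eq_same, smul_eq_mul, mul_one] at h1
        exact MvPolynomial.mem_support_iff.1 hα h1
      · intro β _ hβα
        change (p.coeff β • grToLaurent hψ (grMonomial K χ Ψ (extendExp T β))).coeff _ = 0
        rw [grToLaurent_grMonomial]
        split_ifs with hβI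
        · rw [AddMonoidAlgebra.smul_single, AddMonoidAlgebra.coeff_single, Finsupp.single_apply,
            if_neg]
          exact fun h => hβα (extendExp_injective (torusExp_injOn (hT I hI) hβI hαI h))
        · simp
      · exact fun h => absurd hα h
    refine monomial_mem_stanleyReisnerIdeal ?_ hface _
    rintro rfl
    obtain ⟨I, hI⟩ := cells_nonempty (T := T) hspan
    exact hface I hI (by simp [extendExp])
  · refine Ideal.span_le.2 ?_
    rintro _ ⟨F, hF, hFT, rfl⟩
    set α : {k : Fin r // T.IsMarked k} →₀ ℕ := Finsupp.indicator F fun _ _ => 1 with hα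
    have hsupp : α.support = F := by
      ext k; simp [hα, Finsupp.indicator_apply]
    have hprod : ∏ k ∈ F, (MvPolynomial.X k : MvPolynomial _ K) = MvPolynomial.monomial α 1 := by
      rw [MvPolynomial.monomial_eq, Finsupp.prod, hsupp, map_one, one_mul]
      refine Finset.prod_congr rfl fun k hk => ?_
      rw [hα, Finsupp.indicator_of_mem hk, pow_one]
    have hnil : IsNilpotent (grMonomial K χ Ψ (extendExp T α)) := by
      refine isNilpotent_grMonomial hT hΨ (fun h0 => ?_) fun I hI h => hFT ⟨hF, I, hI, ?_⟩
      · have : α = 0 := extendExp_injective (h0.trans (by simp [extendExp]))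
        rw [this, Finsupp.support_zero] at hsupp
        exact hF.ne_empty hsupp.symm
      · rwa [support_extendExp_subset_iff, hsupp] at h
    rw [SetLike.mem_coe, RingHom.mem_ker, hprod, toRedGr_monomial, one_smul]
    exact Ideal.Quotient.eq_zero_iff_mem.2 hnil

end StanleyReisner

end GKZ

end

theorem mainTheorem12 (K : Type*) [Field K] [IsAlgClosed K] [CharZero K] {d r N : ℕ} (hN : 1 ≤ N)
    (χ : Fin r → Fin d → ℤ) (hχ : Function.Injective χ)
    (hspan : affineSpan ℝ (Set.range (GKZ.pt χ)) = ⊤)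
    (T : GKZ.PolytopalSubdivision χ) (hT : T.IsTriangulation)
    (Ψ : Matrix (Fin N) (Fin r) ℚ) (hΨ : Ψ.map (fun q : ℚ => (q : ℝ)) ∈ GKZ.openGKZCone T N) :
    ∃ e : GKZ.StanleyReisner K T.complex ≃ₐ[K] GKZ.Red (GKZ.nu (K := K) χ Ψ).gr,
      ∀ k : {k : Fin r // T.IsMarked k},
        e (Ideal.Quotient.mk _ (MvPolynomial.X k)) =
          Ideal.Quotient.mk _ ((GKZ.nu (K := K) χ Ψ).initialForm
            (GKZ.restr K χ (MvPolynomial.X k.1))) := by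
  refine ⟨(Ideal.quotientEquivAlgOfEq K (GKZ.ker_toRedGr hspan hT hΨ).symm).trans
    (Ideal.quotientKerAlgEquivOfSurjective (GKZ.toRedGr_surjective hspan hT hΨ)), fun k => ?_⟩
  rw [GKZ.initialForm_restr_X hΨ k.2]
  refine (GKZ.toRedGr_monomial (K := K) (Ψ := Ψ) (T := T) (Finsupp.single k 1) 1).trans ?_
  rw [one_smul, GKZ.extendExp, Finsupp.mapDomain_single]
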